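/- Let $\mathcal X$ be a finite non-empty set, $K\ge 3$, and let $d:\mathcal X\times\mathcal X\to\mathbb R_{\ge 0}$ be any function (a distortion measure), extended to strings by $d(x^n,y^n)=\frac1n\sum_{i=1}^n d(x_i,y_i)$. Write $\mathcal P(\mathcal X)$ for the probability distributions on $\mathcal X$, $\mathcal P_>(\mathcal X)$ for the strictly positive ones, $C(\mathcal X,\mathcal X)$ for the stochastic matrices $(w(y|x))_{x,y\in\mathcal X}$ and $C_0(\mathcal X,\mathcal X)$ for those that are invertible as matrices. The empirical distribution (type) of a string $x^n$ is $\overline N(a|x^n)=\frac1n|\{i:x_i=a\}|$. For $\mathbf W=(W_1,\dots,W_K)\in C(\mathcal X,\mathcal X)^K$ an original $x^n\in\mathcal X^n$ gives rise to $K$ noisy copies $\mathbf y=(y_{ij})$ with probability $\mathbb P(\mathbf y|x^n)=\prod_{i=1}^n\prod_{j=1}^K w_j(y_{ij}|x_i)$. A sequence $\mathcal C=(C_n)_n$ of algorithms $C_n:(\mathcal X^K)^n\to\mathcal X^n$ achieves resolution $D\ge 0$ on $\mathbf W$ with respect to $p\in\mathcal P(\mathcal X)$ if for every $\varepsilon>0$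 there are $N\in\mathbb N$ and $\delta>0$, depending on $p,\mathbf W,\varepsilon$, such that for all $n\ge N$ and all $x^n\in\mathcal X^n$ with $\|\overline N(\cdot|x^n)-p\|_1\le\delta$ $$\mathbb P\Bigl(\min_\tau d\bigl(C_n(\mathbf y),\tau^{\otimes n}(x^n)\bigr)>D\Bigr)<\varepsilon ,$$ where $\tau$ runs over the permutations of $\mathcal X$ (equivalently, this probability tends to $0$ along every sequence $(x^n)_n$ with $\overline N(\cdot|x^n)\to p$). The resolution $\mathcal R(p,\mathbf W)$ is the infimum of all $D$ that are achieved by some $\mathcal C$, which may depend on $p$ and $\mathbf W$. A sequence $\mathcal C$ is universal for $P\subseteq\mathcal P(\mathcal X)$ and $S\subseteq C(\mathcal X,\mathcal X)^K$ if for all $p\in P$ and $\mathbf W\in S$ it achieves every $D>\mathcal R(p,\mathbf W)$. The minimal clairvoyant ambiguous distortion is $$d_{\mathrm{MCA}}(p,\mathbf W)=\min_{\tau,\mathcal T}\ \sum_{x,x'\in\mathcal X}p(x)\,d(x',\tau(x))\sum_{z\in T_{x'}}\ \prod_{j=1}^K w_j(z_j|x),$$ where $\tau$ runs over the permutations of $\mathcal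 X$ and $\mathcal T=(T_x)_{x\in\mathcal X}$ over the partitions of $\mathcal X^K$ (empty parts allowed). A minimizing partition is called an MCA decoder for $(p,\mathbf W)$; it decodes $z\in T_{x'}$ as $x'$. Fix a numbering $\mathcal X=\{x_1,\dots,x_L\}$. For a sequence of tolerances $\eta_n\to0$, a version of UDDA with tolerance $(\eta_n)$ is a sequence of algorithms that, on input $\mathbf y$, forms the empirical distribution $\hat q$ of the $n$ letters $(y_{i1},\dots,y_{iK})\in\mathcal X^K$; then selects $r\in\mathcal P(\mathcal X)$ with $r(x_1)\ge\dots\ge r(x_L)$ and $\mathbf V\in C(\mathcal X,\mathcal X)^K$ for which $\bigl\|\sum_x r(x)\bigotimes_j v_j(\cdot|x)-\hat q\bigr\|_1$ exceeds the infimum over all such $(r,\mathbf V)$ by at most $\eta_n$ (the DCA fit); then selects an MCA decoder for $(r,\mathbf V)$; and applies it to each letter $(y_{i1},\dots,y_{iK})$. The version is exact if $\eta_n=0$ for all $n$. Theorem. 1. For all $p\in\mathcal P(\mathcal X)$ and $\mathbf W\in C_0(\mathcal X,\mathcal X)^K$, $\mathcal R(p,\mathbf W)=d_{\mathrm{MCA}}(p,\mathbf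 W)$. If moreover $d(\sigma(x),\sigma(x'))=d(x,x')$ for all permutations $\sigma$ (for instance, if $d$ is the Hamming distance), then also $$\mathcal R(p,\mathbf W)=\min_{\tau,\mathcal T}\sum_{x,x'}p(x)\,d(x,x')\sum_{z\in T_{\tau(x')}}\prod_{j=1}^K w_j(z_j|x).$$ 2. There is a version of UDDA, for some tolerances $\eta_n\to0$, that is universal for $\mathcal P(\mathcal X)$ and $C_0(\mathcal X,\mathcal X)^K$. 3. Exact versions of UDDA exist, and every version of UDDA, whatever its tolerances $\eta_n\to 0$ and its selections, is universal for $\mathcal P_>(\mathcal X)$ and $C_0(\mathcal X,\mathcal X)^K$. -/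

import Mathlib

open scoped BigOperators

noncomputable section

namespace Denoising

/-- `W` is a channel (a stochastic matrix) from `X` to `Y`; the entry `W x y` is `w(y|x)`. -/
def IsChannel {X Y : Type*} [Fintype Y] (W : Matrix X Y ℝ) : Prop :=
  (∀ x y, 0 ≤ W x y) ∧ ∀ x, ∑ y, W x y = 1

/-- The `K`-tuples of channels from `X` to `X`. -/
def channelTuples (X : Type*) [Fintype X] (K : ℕ) : Set (Fin K → Matrix X X ℝ) :=
  {W | ∀ j, IsChannel (W j)}

/-- The `K`-tuples of channels from `X` to `X` whose stochastic matrices are all invertible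
(the inverse matrices need not be stochastic). -/
def invertibleTuples (X : Type*) [Fintype X] [DecidableEq X] (K : ℕ) :
    Set (Fin K → Matrix X X ℝ) :=
  {W | ∀ j, IsChannel (W j) ∧ IsUnit (W j)}

/-- The strictly positive probability distributions on `X`. -/
def posDistributions (X : Type*) [Fintype X] : Set (X → ℝ) :=
  {p | p ∈ stdSimplex ℝ X ∧ ∀ x, 0 < p x}

/-- The type (empirical distribution) of a string of length `n` over the alphabet `A`. -/
def empirical {A : Type*} [DecidableEq A] {n : ℕ} (x : Fin n → A) (a : A) : ℝ :=
  ((Finset.univ.filter fun i => x i = a).card : ℝ) / n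

/-- The `ℓ¹`-distance of two real vectors. -/
def l1dist {A : Type*} [Fintype A] (p q : A → ℝ) : ℝ := ∑ a, |p a - q a|

/-- The channel from `X` to `X ^ K` that feeds one and the same input letter independently
into each of the `K` channels: the tensor product of the `W j` after the diagonal channel. -/
def jointChannel {X : Type*} {K : ℕ} (W : Fin K → Matrix X X ℝ) : Matrix X (Fin K → X) ℝ :=
  fun x z => ∏ j, W j x (z j)

/-- The output distribution on `X ^ K` of the dependent component system `(r, V)`. -/
def outputDist {X : Type*} [Fintype X] {K : ℕ} (r : X → ℝ) (V : Fin K → Matrix X X ℝ)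
    (z : Fin K → X) : ℝ :=
  ∑ x, r x * jointChannel V x z

/-- The probability of the event `A` about the matrix of the `K` noisy copies of the string `x`;
every letter of every copy is distorted independently. -/
def prob {X : Type*} [Fintype X] [DecidableEq X] {K n : ℕ} (W : Fin K → Matrix X X ℝ)
    (x : Fin n → X) (A : Set (Fin n → Fin K → X)) : ℝ :=
  ∑ y, A.indicator (fun y => ∏ i, ∏ j, W j (x i) (y i j)) y

/-- The extension of a distortion measure `d` to strings of length `n`. -/
def strDist {X : Type*} {n : ℕ} (d : X → X → ℝ) (x y : Fin n → X) : ℝ :=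
  (∑ i, d (x i) (y i)) / n

/-- The distortion between a recovered string `xhat` and the original `x`, up to relabelling of
the colours of the original: a minimum over all permutations of `X`. -/
def ambigDist {X : Type*} {n : ℕ} (d : X → X → ℝ) (xhat x : Fin n → X) : ℝ :=
  ⨅ τ : Equiv.Perm X, strDist d xhat fun i => τ (x i)

/-- A sequence of algorithms, which recover a string from `K` noisy copies. -/
abbrev Algorithms (X : Type*) (K : ℕ) : Type _ :=
  ∀ n : ℕ, (Fin n → Fin K → X) → (Fin n → X)

/-- `C` achieves resolution `D` on `W` with respect to `p`: the distortion up to relabelling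
exceeds `D` with small probability, for all long strings with a type close to `p`. Equivalently,
this probability tends to `0` along every sequence of strings whose types converge to `p`. -/
def Achieves {X : Type*} [Fintype X] [DecidableEq X] {K : ℕ} (d : X → X → ℝ)
    (p : X → ℝ) (W : Fin K → Matrix X X ℝ) (C : Algorithms X K) (D : ℝ) : Prop :=
  0 ≤ D ∧ ∀ ε : ℝ, 0 < ε → ∃ N : ℕ, ∃ δ : ℝ, 0 < δ ∧ ∀ n : ℕ, N ≤ n → ∀ x : Fin n → X,
    l1dist (empirical x) p ≤ δ → prob W x {y | D < ambigDist d (C n y) x} < ε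

/-- The resolution of `W` with respect to `p`. -/
def resolution {X : Type*} [Fintype X] [DecidableEq X] {K : ℕ} (d : X → X → ℝ)
    (p : X → ℝ) (W : Fin K → Matrix X X ℝ) : ℝ :=
  sInf {D : ℝ | ∃ C : Algorithms X K, Achieves d p W C D}

/-- `C` is universal for the distributions in `P` and the tuples of channels in `S`: it achieves
everything above the resolution, although it knows neither the distribution nor the channels. -/
def IsUniversalOn {X : Type*} [Fintype X] [DecidableEq X] {K : ℕ} (d : X → X → ℝ)
    (P : Set (X → ℝ)) (S : Set (Fin K → Matrix X X ℝ)) (C : Algorithms X K) : Prop :=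
  ∀ p ∈ P, ∀ W ∈ S, ∀ D : ℝ, resolution d p W < D → Achieves d p W C D

/-- The expected distortion, with the original relabelled by `τ`, of the decoder given by the
partition `T x' = {y | f y = x'}` of `Y`. (Partitions indexed by `X`, with empty parts allowed,
are the same as functions `Y → X`.) -/
def mcaCost {X Y : Type*} [Fintype X] [DecidableEq X] [Fintype Y] (d : X → X → ℝ)
    (p : X → ℝ) (W : Matrix X Y ℝ) (τ : Equiv.Perm X) (f : Y → X) : ℝ :=
  ∑ x, ∑ x', p x * d x' (τ x) * ∑ y with f y = x', W x y

/-- The minimal clairvoyant ambiguous distortion of a channel from `X` to `Y`. -/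
def dMCA {X Y : Type*} [Fintype X] [DecidableEq X] [Fintype Y] (d : X → X → ℝ)
    (p : X → ℝ) (W : Matrix X Y ℝ) : ℝ :=
  ⨅ s : Equiv.Perm X × (Y → X), mcaCost d p W s.1 s.2

/-- The variant of `dMCA` in which the permutation relabels the parts of the partition and
not the original. -/
def dMCAParts {X Y : Type*} [Fintype X] [DecidableEq X] [Fintype Y] (d : X → X → ℝ)
    (p : X → ℝ) (W : Matrix X Y ℝ) : ℝ :=
  ⨅ s : Equiv.Perm X × (Y → X), ∑ x, ∑ x', p x * d x x' * ∑ y with s.2 y = s.1 x', W x y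

/-- `f` is an MCA decoder for `(p, W)`: its partition attains the minimum in `dMCA`. -/
def IsMCADecoder {X Y : Type*} [Fintype X] [DecidableEq X] [Fintype Y] (d : X → X → ℝ)
    (p : X → ℝ) (W : Matrix X Y ℝ) (f : Y → X) : Prop :=
  ∃ τ : Equiv.Perm X, ∀ (τ' : Equiv.Perm X) (f' : Y → X), mcaCost d p W τ f ≤ mcaCost d p W τ' f'

/-- The candidates of a DCA fit: a probability distribution that is non-increasing with respect
to the numbering `e` of `X`, and `K` channels. -/
def dcaCandidates {X : Type*} [Fintype X] (K : ℕ) (e : X ≃ Fin (Fintype.card X)) :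
    Set ((X → ℝ) × (Fin K → Matrix X X ℝ)) :=
  {c | c.1 ∈ stdSimplex ℝ X ∧ (∀ x x', e x ≤ e x' → c.1 x' ≤ c.1 x) ∧ c.2 ∈ channelTuples X K}

/-- `(r, V)` minimizes, up to the tolerance `η`, the `ℓ¹`-distance of the output distribution to
`q` among all candidates. An exact minimizer is the case `η = 0`. By continuity the infimum is
the same if only strictly positive non-increasing distributions are admitted, so that a
minimizer within that smaller set is a minimizer here as well. -/
def IsDCAFit {X : Type*} [Fintype X] {K : ℕ} (e : X ≃ Fin (Fintype.card X)) (η : ℝ)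
    (q : (Fin K → X) → ℝ) (r : X → ℝ) (V : Fin K → Matrix X X ℝ) : Prop :=
  (r, V) ∈ dcaCandidates K e ∧
    ∀ c ∈ dcaCandidates K e, l1dist (outputDist r V) q ≤ l1dist (outputDist c.1 c.2) q + η

/-- `C` is a version of the universal discrete denoising algorithm: on input `y` it forms the
empirical distribution of the columns in `X ^ K`, fits a dependent component system `(r, V)` to
it up to the tolerance `η n`, picks an MCA decoder for `(r, V)` and applies it to each column. -/
def IsUDDA {X : Type*} [Fintype X] [DecidableEq X] {K : ℕ} (d : X → X → ℝ)
    (e : X ≃ Fin (Fintype.card X)) (η : ℕ → ℝ) (C : Algorithms X K) : Prop :=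
  ∀ (n : ℕ) (y : Fin n → Fin K → X), ∃ (r : X → ℝ) (V : Fin K → Matrix X X ℝ) (f : (Fin K → X) → X),
    IsDCAFit e (η n) (empirical y) r V ∧ IsMCADecoder d r (jointChannel V) f ∧
      ∀ i, C n y i = f (y i)

end Denoising

end

/-!
Everything reduces to the identity `resolution d p W = dMCA d p (jointChannel W)`, which holds for
all channels, and to the identifiability of dependent component systems with invertible channels.

*The resolution.* An MCA decoder for `(p, W)`, applied to every column, has a distortion that is an
average of independent variables with mean close to `dMCA`, so Chebyshev's inequality shows that
everything above `dMCA` is achieved (`achieves_of_isMCADecoder`, where the decoder may be chosen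
depending on the columns, as there are finitely many). Conversely (`dMCA_le_of_achieves`), let the
letters of the original be random, independent and distributed as `p`. Given the columns they are
still independent, now with the posterior distributions, so for every fixed permutation `τ` the
distortion is, up to a small error, at least the average over the columns of the minimal posterior
cost. This average is concentrated around a number that is at least `dMCA`. A union bound over `τ`
and the concentration of the type of the original around `p` finish the argument.

*Identifiability.* Suppose that `(p, W)` and `(r, V)` have the same output distribution and that
all channels are invertible. Testing the output distribution against a column of `(V i)⁻¹` in one
coordinate, a column of `(W j)⁻¹` in another and anything in a third one gives an equation between
single products. It shows that the rows of `V` and `W` at inputs of positive probability agree up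
to one permutation, which also carries `p` to `r` (`exists_perm_of_outputDist_eq`). In particular
both systems have the same MCA decoders. If `p` is strictly positive, invertibility of `W` alone is
enough (`mem_invertibleTuples_of_outputDist_eq`).

*Universality.* The type of the columns is close to the output distribution of `(p, W)`, hence so is
the output distribution of the fit. By compactness, and because there are only finitely many
decoders, an MCA decoder of the fit is then one of `(p, W)`, provided that the fit is taken from a
compact set in which identifiability applies (`achieves_of_fits`). For strictly positive `p` the set
of all candidates will do. If `p` has zeros, non-invertible systems may have the output distribution
of `(p, W)` and different decoders. They are avoided by a tolerance `n ^ (-1/4)`, which exceeds the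
random fluctuations, and by selecting among the admissible fits one that maximizes `|∏ det V j|`:
the true channels are admissible, so the determinants of the selected ones are bounded below
(`exists_isUDDA_isUniversalOn`).
-/

open scoped BigOperators

namespace Denoising

/-! ### Independent letters and Chebyshev's inequality -/

/-- The probability of the event `S` about a string whose letters are independent, the `i`-th one
having the distribution `w i`. -/
noncomputable def prodProb {A : Type*} [Fintype A] {n : ℕ} (w : Fin n → A → ℝ)
    (S : Set (Fin n → A)) : ℝ :=
  ∑ y, S.indicator (fun y => ∏ i, w i (y i)) y

section Product

variable {A : Type*} [Fintype A] {n : ℕ}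

theorem sum_prod_apply {ι : Type*} [Fintype ι] [DecidableEq ι] (w : ι → A → ℝ) :
    ∑ y : ι → A, ∏ i, w i (y i) = ∏ i, ∑ a, w i a := by
  rw [Finset.prod_univ_sum, Fintype.piFinset_univ]

theorem prodProb_mono {w : Fin n → A → ℝ} (hw : ∀ i a, 0 ≤ w i a) {S T : Set (Fin n → A)}
    (h : S ⊆ T) : prodProb w S ≤ prodProb w T :=
  Finset.sum_le_sum fun y _ =>
    Set.indicator_le_indicator_of_subset h (fun y => Finset.prod_nonneg fun i _ => hw i (y i)) y

theorem prodProb_nonneg {w : Fin n → A → ℝ} (hw : ∀ i a, 0 ≤ w i a) (S : Set (Fin n → A)) :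
    0 ≤ prodProb w S :=
  Finset.sum_nonneg fun _ _ =>
    Set.indicator_nonneg (fun y _ => Finset.prod_nonneg fun i _ => hw i (y i)) _

theorem prodProb_union_le {w : Fin n → A → ℝ} (hw : ∀ i a, 0 ≤ w i a) (S T : Set (Fin n → A)) :
    prodProb w (S ∪ T) ≤ prodProb w S + prodProb w T := by
  classical
  unfold prodProb
  rw [← Finset.sum_add_distrib]
  refine Finset.sum_le_sum fun y _ => ?_
  have := Finset.prod_nonneg fun i (_ : i ∈ Finset.univ) => hw i (y i)
  simp only [Set.indicator_apply, Set.mem_union]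
  split_ifs <;> simp_all

theorem prodProb_exists_le {w : Fin n → A → ℝ} (hw : ∀ i a, 0 ≤ w i a) {κ : Type*} [Fintype κ]
    (S : κ → Set (Fin n → A)) :
    prodProb w {y | ∃ k, y ∈ S k} ≤ ∑ k, prodProb w (S k) := by
  classical
  unfold prodProb
  rw [Finset.sum_comm]
  refine Finset.sum_le_sum fun y _ => ?_
  have hp := Finset.prod_nonneg fun i (_ : i ∈ Finset.univ) => hw i (y i)
  have hk : ∀ k ∈ Finset.univ, 0 ≤ (S k).indicator (fun y => ∏ i, w i (y i)) y := fun k _ =>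
    Set.indicator_apply_nonneg fun _ => hp
  by_cases h : y ∈ {y | ∃ k, y ∈ S k}
  · obtain ⟨k, hy⟩ := h
    rw [Set.indicator_of_mem (show y ∈ {y | ∃ k, y ∈ S k} from ⟨k, hy⟩)]
    refine le_trans (le_of_eq ?_) (Finset.single_le_sum hk (Finset.mem_univ k))
    rw [Set.indicator_of_mem hy]
  · rw [Set.indicator_of_notMem h]
    exact Finset.sum_nonneg hk

theorem prodProb_add_compl {w : Fin n → A → ℝ} (hw : ∀ i, ∑ a, w i a = 1)
    (S : Set (Fin n → A)) : prodProb w S + prodProb w Sᶜ = 1 := by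
  unfold prodProb
  rw [← Finset.sum_add_distrib]
  calc _ = ∑ y : Fin n → A, ∏ i, w i (y i) := Finset.sum_congr rfl fun y _ => by
        rw [← Pi.add_apply, Set.indicator_self_add_compl]
    _ = 1 := by rw [sum_prod_apply]; simp [hw]

/-- The second moment of a sum of independent centred variables is the sum of the second
moments. -/
theorem sum_prod_mul_sum_sq {w g : Fin n → A → ℝ} (hw : ∀ i, ∑ a, w i a = 1)
    (hg : ∀ i, ∑ a, w i a * g i a = 0) :
    ∑ y : Fin n → A, (∏ i, w i (y i)) * (∑ i, g i (y i)) ^ 2 = ∑ i, ∑ a, w i a * g i a ^ 2 := by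
  have key : ∀ i j, ∑ y : Fin n → A, (∏ k, w k (y k)) * (g i (y i) * g j (y j)) =
      if i = j then ∑ a, w i a * g i a ^ 2 else 0 := by
    intro i j
    have h1 : ∀ y : Fin n → A, (∏ k, w k (y k)) * (g i (y i) * g j (y j)) =
        ∏ k, (w k (y k) * ((if k = i then g k (y k) else 1) *
          (if k = j then g k (y k) else 1))) := by
      intro y
      rw [Finset.prod_mul_distrib, Finset.prod_mul_distrib]
      simp
    simp_rw [h1]
    rw [sum_prod_apply (fun k a => w k a * ((if k = i then g k a else 1) *
          (if k = j then g k a else 1)))]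
    split_ifs with hij
    · subst hij
      rw [Finset.prod_eq_single i]
      · simp [sq]
      · intro k _ hk
        simp [hk, hw]
      · simp
    · apply Finset.prod_eq_zero (Finset.mem_univ i)
      simp [hij, hg]
  calc _ = ∑ y : Fin n → A, ∑ i, ∑ j, (∏ k, w k (y k)) * (g i (y i) * g j (y j)) := by
        refine Finset.sum_congr rfl fun y _ => ?_
        rw [sq, Finset.sum_mul_sum, Finset.mul_sum]
        simp_rw [Finset.mul_sum]
    _ = ∑ i, ∑ j, ∑ y : Fin n → A, (∏ k, w k (y k)) * (g i (y i) * g j (y j)) := by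
        rw [Finset.sum_comm]
        exact Finset.sum_congr rfl fun i _ => Finset.sum_comm
    _ = _ := by simp [key]

theorem prodProb_le_of_centred {w g : Fin n → A → ℝ} {B s : ℝ} (hw0 : ∀ i a, 0 ≤ w i a)
    (hw : ∀ i, ∑ a, w i a = 1) (hg : ∀ i, ∑ a, w i a * g i a = 0)
    (hB : ∀ i a, |g i a| ≤ B) (hn : 0 < n) (hs : 0 < s) :
    prodProb w {y | s ≤ |(∑ i, g i (y i)) / n|} ≤ B ^ 2 / (n * s ^ 2) := by
  have hn' : (0 : ℝ) < n := by exact_mod_cast hn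
  rw [le_div_iff₀ (by positivity)]
  have h1 : prodProb w {y | s ≤ |(∑ i, g i (y i)) / n|} * (n * s) ^ 2 ≤
      ∑ y : Fin n → A, (∏ i, w i (y i)) * (∑ i, g i (y i)) ^ 2 := by
    unfold prodProb
    rw [Finset.sum_mul]
    refine Finset.sum_le_sum fun y _ => ?_
    have hp := Finset.prod_nonneg fun i (_ : i ∈ Finset.univ) => hw0 i (y i)
    by_cases hy : y ∈ {y : Fin n → A | s ≤ |(∑ i, g i (y i)) / n|}
    · rw [Set.indicator_of_mem hy]
      refine mul_le_mul_of_nonneg_left ?_ hp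
      rw [Set.mem_ofPred_eq, abs_div, Nat.abs_cast, le_div_iff₀ hn'] at hy
      rw [← sq_abs (∑ i, g i (y i))]
      exact pow_le_pow_left₀ (by positivity) (by linarith) 2
    · rw [Set.indicator_of_notMem hy, zero_mul]
      exact mul_nonneg hp (sq_nonneg _)
  have h2 : ∑ i, ∑ a, w i a * g i a ^ 2 ≤ n * B ^ 2 := by
    calc _ ≤ ∑ i : Fin n, ∑ a, w i a * B ^ 2 := by
          refine Finset.sum_le_sum fun i _ => Finset.sum_le_sum fun a _ => ?_
          refine mul_le_mul_of_nonneg_left ?_ (hw0 i a)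
          rw [← sq_abs]
          exact pow_le_pow_left₀ (abs_nonneg _) (hB i a) 2
      _ = n * B ^ 2 := by simp [← Finset.sum_mul, hw]
  rw [sum_prod_mul_sum_sq hw hg] at h1
  have h3 := h1.trans h2
  have : (n : ℝ) * (prodProb w {y | s ≤ |(∑ i, g i (y i)) / n|} * (n * s ^ 2)) ≤ n * B ^ 2 := by
    calc _ = prodProb w {y | s ≤ |(∑ i, g i (y i)) / n|} * (n * s) ^ 2 := by ring
      _ ≤ _ := h3
  exact le_of_mul_le_mul_left this hn'

theorem sum_mul_mem_Icc {w h : A → ℝ} {B : ℝ} (hw0 : ∀ a, 0 ≤ w a) (hw : ∑ a, w a = 1)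
    (h0 : ∀ a, 0 ≤ h a) (hB : ∀ a, h a ≤ B) : ∑ a, w a * h a ∈ Set.Icc 0 B := by
  refine ⟨Finset.sum_nonneg fun a _ => mul_nonneg (hw0 a) (h0 a), ?_⟩
  calc _ ≤ ∑ a, w a * B := Finset.sum_le_sum fun a _ => mul_le_mul_of_nonneg_left (hB a) (hw0 a)
    _ = B := by rw [← Finset.sum_mul, hw, one_mul]

/-- Chebyshev's inequality for the average of independent variables with values in `[0, B]`. -/
theorem prodProb_deviation_le {w h : Fin n → A → ℝ} {B s : ℝ} (hw0 : ∀ i a, 0 ≤ w i a)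
    (hw : ∀ i, ∑ a, w i a = 1) (h0 : ∀ i a, 0 ≤ h i a)
    (hB : ∀ i a, h i a ≤ B) (hn : 0 < n) (hs : 0 < s) :
    prodProb w {y | s ≤ |(∑ i, h i (y i)) / n - (∑ i, ∑ a, w i a * h i a) / n|} ≤
      B ^ 2 / (n * s ^ 2) := by
  have := prodProb_le_of_centred (w := w) (g := fun i a => h i a - ∑ b, w i b * h i b)
    (B := B) hw0 hw (fun i => ?_) (fun i a => ?_) hn hs
  · simpa only [Finset.sum_sub_distrib, sub_div] using this
  · simp [mul_sub, Finset.sum_sub_distrib, ← Finset.sum_mul, hw]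
  · obtain ⟨h1, h2⟩ := sum_mul_mem_Icc (hw0 i) (hw i) (h0 i) (hB i)
    rw [abs_le]
    constructor <;> linarith [h0 i a, hB i a]

end Product

/-! ### Types and output distributions -/

section Types

variable {A : Type*} [Fintype A]

theorem l1dist_comm (p q : A → ℝ) : l1dist p q = l1dist q p := by
  simp only [l1dist, abs_sub_comm]

theorem l1dist_triangle (p q r : A → ℝ) : l1dist p r ≤ l1dist p q + l1dist q r := by
  unfold l1dist
  rw [← Finset.sum_add_distrib]
  exact Finset.sum_le_sum fun a _ => abs_sub_le _ _ _

theorem l1dist_nonneg (p q : A → ℝ) : 0 ≤ l1dist p q :=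
  Finset.sum_nonneg fun _ _ => abs_nonneg _

theorem l1dist_eq_zero {p q : A → ℝ} : l1dist p q = 0 ↔ p = q := by
  unfold l1dist
  rw [Finset.sum_eq_zero_iff_of_nonneg fun _ _ => abs_nonneg _]
  simp [sub_eq_zero, funext_iff]

theorem abs_sum_mul_sub_le {p q φ : A → ℝ} {B : ℝ} (hφ : ∀ a, |φ a| ≤ B) :
    |∑ a, p a * φ a - ∑ a, q a * φ a| ≤ l1dist p q * B := by
  rw [← Finset.sum_sub_distrib, l1dist, Finset.sum_mul]
  refine (Finset.abs_sum_le_sum_abs _ _).trans (Finset.sum_le_sum fun a _ => ?_)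
  rw [← sub_mul, abs_mul]
  exact mul_le_mul_of_nonneg_left (hφ a) (abs_nonneg _)

variable [DecidableEq A] {n : ℕ}

theorem sum_empirical_mul (x : Fin n → A) (φ : A → ℝ) :
    ∑ a, empirical x a * φ a = (∑ i, φ (x i)) / n := by
  have : ∑ i, φ (x i) = ∑ a, ((Finset.univ.filter fun i => x i = a).card : ℝ) * φ a := by
    rw [← Finset.sum_fiberwise_of_maps_to (g := x) (t := Finset.univ) (by simp)]
    refine Finset.sum_congr rfl fun a _ => ?_
    rw [Finset.sum_congr rfl (g := fun _ => φ a) (by simp +contextual)]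
    simp
  rw [this, Finset.sum_div]
  exact Finset.sum_congr rfl fun a _ => by unfold empirical; ring

theorem empirical_eq {A : Type*} [DecidableEq A] {n : ℕ} (x : Fin n → A) (a : A) :
    empirical x a = (∑ i, if x i = a then (1 : ℝ) else 0) / n := by
  simp [empirical]

theorem empirical_mem_stdSimplex (x : Fin n → A) (hn : 0 < n) :
    empirical x ∈ stdSimplex ℝ A := by
  refine ⟨fun a => by unfold empirical; positivity, ?_⟩
  have := sum_empirical_mul x fun _ => 1
  simp only [mul_one, Finset.sum_const, Finset.card_univ, Fintype.card_fin, nsmul_eq_mul] at this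
  rw [this, div_self]
  exact_mod_cast hn.ne'

/-- The type of a string of independent letters is close to the average of their
distributions. -/
theorem prodProb_l1dist_empirical_le {w : Fin n → A → ℝ} {s : ℝ} (hw0 : ∀ i a, 0 ≤ w i a)
    (hw : ∀ i, ∑ a, w i a = 1) (hn : 0 < n) (hs : 0 < s) :
    prodProb w {y | s < l1dist (empirical y) fun a => (∑ i, w i a) / n} ≤
      (Fintype.card A : ℝ) ^ 3 / (n * s ^ 2) := by
  rcases isEmpty_or_nonempty A with hA | hA
  · have : {y : Fin n → A | s < l1dist (empirical y) fun a => (∑ i, w i a) / n} = ∅ := by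
      ext y
      simp [l1dist, hs.le]
    rw [this]
    simp only [prodProb, Set.indicator_empty, Finset.sum_const_zero]
    positivity
  have hc : (0 : ℝ) < Fintype.card A := by exact_mod_cast Fintype.card_pos
  have hsub : {y : Fin n → A | s < l1dist (empirical y) fun a => (∑ i, w i a) / n} ⊆
      {y | ∃ a, y ∈ {y : Fin n → A | s / Fintype.card A ≤
        |(∑ i, if y i = a then (1 : ℝ) else 0) / n -
          (∑ i, ∑ b, w i b * if b = a then (1 : ℝ) else 0) / n|}} := by
    intro y hy
    by_contra hcon
    simp only [Set.mem_ofPred_eq, not_exists, not_le, ← empirical_eq] at hcon hy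
    refine hy.not_ge ?_
    unfold l1dist
    calc _ ≤ ∑ _a : A, s / Fintype.card A := Finset.sum_le_sum fun a _ => by
            simpa using (hcon a).le
      _ = s := by simp; field_simp
  refine (prodProb_mono hw0 hsub).trans ((prodProb_exists_le hw0 _).trans ?_)
  calc _ ≤ ∑ _a : A, (1 : ℝ) ^ 2 / (n * (s / Fintype.card A) ^ 2) :=
        Finset.sum_le_sum fun a _ => prodProb_deviation_le
          (h := fun _ b => if b = a then (1 : ℝ) else 0) hw0 hw
          (fun i b => by split_ifs <;> norm_num) (fun i b => by split_ifs <;> norm_num) hn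
          (by positivity)
    _ = _ := by
        simp only [Finset.sum_const, Finset.card_univ, nsmul_eq_mul]
        have : (n : ℝ) ≠ 0 := by exact_mod_cast hn.ne'
        field_simp

end Types

section Channels

variable {X : Type*} [Fintype X] {K : ℕ}

theorem isChannel_jointChannel {W : Fin K → Matrix X X ℝ} (hW : W ∈ channelTuples X K) :
    IsChannel (jointChannel W) := by
  refine ⟨fun x z => Finset.prod_nonneg fun j _ => (hW j).1 _ _, fun x => ?_⟩
  unfold jointChannel
  rw [sum_prod_apply (fun j a => W j x a)]
  exact Finset.prod_eq_one fun j _ => (hW j).2 x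

theorem invertibleTuples_subset [DecidableEq X] : invertibleTuples X K ⊆ channelTuples X K :=
  fun _ h j => (h j).1

theorem l1dist_outputDist_le {W : Fin K → Matrix X X ℝ} (hW : W ∈ channelTuples X K)
    (p q : X → ℝ) : l1dist (outputDist p W) (outputDist q W) ≤ l1dist p q := by
  have hJ := isChannel_jointChannel hW
  unfold l1dist outputDist
  calc _ ≤ ∑ z, ∑ x, |p x - q x| * jointChannel W x z := by
        refine Finset.sum_le_sum fun z _ => ?_
        rw [← Finset.sum_sub_distrib]
        refine (Finset.abs_sum_le_sum_abs _ _).trans (le_of_eq (Finset.sum_congr rfl fun x _ => ?_))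
        rw [← sub_mul, abs_mul, abs_of_nonneg (hJ.1 x z)]
    _ = _ := by
        rw [Finset.sum_comm]
        simp [← Finset.mul_sum, hJ.2]

/-- Whatever the original string, the type of the columns concentrates around the output
distribution of the type of the original. -/
theorem prob_l1dist_empirical_le [DecidableEq X] {W : Fin K → Matrix X X ℝ}
    (hW : W ∈ channelTuples X K) {n : ℕ} (hn : 0 < n) (x : Fin n → X) {s : ℝ} (hs : 0 < s) :
    prob W x {y | s < l1dist (empirical y) (outputDist (empirical x) W)} ≤
      (Fintype.card (Fin K → X) : ℝ) ^ 3 / (n * s ^ 2) := by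
  have hJ := isChannel_jointChannel hW
  have := prodProb_l1dist_empirical_le (w := fun i => jointChannel W (x i))
    (fun i => hJ.1 (x i)) (fun i => hJ.2 (x i)) hn hs
  have h2 : (fun z => (∑ i, jointChannel W (x i) z) / n) = outputDist (empirical x) W := by
    funext z
    exact (sum_empirical_mul x fun a => jointChannel W a z).symm
  rw [h2] at this
  exact this

end Channels

/-! ### Decoders and the minimal clairvoyant ambiguous distortion -/

section MCA

variable {X Y : Type*} [Fintype X] [DecidableEq X] [Fintype Y] {d : X → X → ℝ} {p : X → ℝ}
  {W : Matrix X Y ℝ}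

theorem mcaCost_eq (d : X → X → ℝ) (p : X → ℝ) (W : Matrix X Y ℝ) (τ : Equiv.Perm X)
    (f : Y → X) : mcaCost d p W τ f = ∑ x, p x * ∑ z, W x z * d (f z) (τ x) := by
  unfold mcaCost
  refine Finset.sum_congr rfl fun x _ => ?_
  simp_rw [mul_assoc]
  rw [← Finset.mul_sum, ← Finset.sum_fiberwise Finset.univ f fun z => W x z * d (f z) (τ x)]
  congr 1
  refine Finset.sum_congr rfl fun x' _ => ?_
  rw [Finset.mul_sum]
  refine Finset.sum_congr rfl fun z hz => ?_
  rw [(Finset.mem_filter.1 hz).2, mul_comm]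

theorem dMCA_le (d : X → X → ℝ) (p : X → ℝ) (W : Matrix X Y ℝ) (τ : Equiv.Perm X) (f : Y → X) :
    dMCA d p W ≤ mcaCost d p W τ f :=
  ciInf_le (f := fun s : Equiv.Perm X × (Y → X) => mcaCost d p W s.1 s.2)
    (Set.finite_range _).bddBelow (τ, f)

theorem isMCADecoder_iff {f : Y → X} :
    IsMCADecoder d p W f ↔ ∃ τ, mcaCost d p W τ f = dMCA d p W := by
  refine exists_congr fun τ => ⟨fun h => le_antisymm ?_ (dMCA_le d p W τ f), fun h τ' f' => ?_⟩
  · have : Nonempty (Equiv.Perm X × (Y → X)) := ⟨(τ, f)⟩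
    exact le_ciInf fun s => h s.1 s.2
  · exact h.trans_le (dMCA_le d p W τ' f')

theorem exists_isMCADecoder [Nonempty X] (d : X → X → ℝ) (p : X → ℝ) (W : Matrix X Y ℝ) :
    ∃ f, IsMCADecoder d p W f := by
  obtain ⟨s, hs⟩ := exists_eq_ciInf_of_finite
    (f := fun s : Equiv.Perm X × (Y → X) => mcaCost d p W s.1 s.2)
  exact ⟨s.2, isMCADecoder_iff.2 ⟨s.1, hs⟩⟩

theorem dMCA_nonneg (hd : ∀ x x', 0 ≤ d x x') (hp : ∀ x, 0 ≤ p x) (hW : ∀ x y, 0 ≤ W x y) :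
    0 ≤ dMCA d p W := by
  refine Real.iInf_nonneg fun s => ?_
  rw [mcaCost_eq]
  exact Finset.sum_nonneg fun x _ => mul_nonneg (hp x)
    (Finset.sum_nonneg fun z _ => mul_nonneg (hW x z) (hd _ _))

/-- A distortion measure that is invariant under all permutations is symmetric, by invariance
under transpositions; hence the relabelling can be moved from the original to the parts. -/
theorem dMCAParts_eq (hd : ∀ (σ : Equiv.Perm X) (x x' : X), d (σ x) (σ x') = d x x') :
    dMCAParts d p W = dMCA d p W := by
  have hsymm : ∀ x x', d x x' = d x' x := fun x x' => by
    rw [← hd (Equiv.swap x x') x x', Equiv.swap_apply_left, Equiv.swap_apply_right]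
  unfold dMCAParts dMCA
  congr 1
  funext s
  unfold mcaCost
  refine Finset.sum_congr rfl fun x _ => ?_
  rw [← Equiv.sum_comp s.1 fun x' => p x * d x' (s.1 x) * ∑ y with s.2 y = x', W x y]
  exact Finset.sum_congr rfl fun x' _ => by rw [hd, hsymm]

end MCA

theorem exists_distortion_bound {X : Type*} [Fintype X] (d : X → X → ℝ) (hd : ∀ x x', 0 ≤ d x x') :
    ∃ B, 0 < B ∧ ∀ x x', d x x' ≤ B := by
  refine ⟨1 + ∑ x, ∑ x', d x x', ?_, fun x x' => ?_⟩
  · have : 0 ≤ ∑ x, ∑ x', d x x' :=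
      Finset.sum_nonneg fun x _ => Finset.sum_nonneg fun x' _ => hd x x'
    linarith
  · have h1 := Finset.single_le_sum (fun x' _ => hd x x') (Finset.mem_univ x')
    have h2 := Finset.single_le_sum (f := fun x => ∑ x', d x x')
      (fun x _ => Finset.sum_nonneg fun x' _ => hd x x') (Finset.mem_univ x)
    linarith

/-! ### Achievability -/

section Achievability

variable {X : Type*} [Fintype X] [DecidableEq X] {K : ℕ} {d : X → X → ℝ} {p : X → ℝ}
  {W : Fin K → Matrix X X ℝ}

theorem ambigDist_le {X : Type*} [Finite X] {n : ℕ} (d : X → X → ℝ) (xhat x : Fin n → X)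
    (τ : Equiv.Perm X) :
    ambigDist d xhat x ≤ strDist d xhat fun i => τ (x i) :=
  ciInf_le (f := fun τ : Equiv.Perm X => strDist d xhat fun i => τ (x i))
    (Set.finite_range _).bddBelow τ

theorem exists_nat_div_mul_sq_lt (c s : ℝ) {ε : ℝ} (hε : 0 < ε) :
    ∃ N : ℕ, 0 < N ∧ ∀ n : ℕ, N ≤ n → c / (n * s ^ 2) < ε := by
  have h : Filter.Tendsto (fun n : ℕ => c / s ^ 2 / n) Filter.atTop (nhds 0) :=
    tendsto_const_div_atTop_nhds_zero_nat _
  obtain ⟨N, hN⟩ := Filter.eventually_atTop.1 (h.eventually_lt_const hε)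
  refine ⟨N + 1, N.succ_pos, fun n hn => ?_⟩
  have := hN n (by omega)
  rwa [div_div, mul_comm] at this

/-- A fixed MCA decoder for `(p, W)`, applied to every column, rarely exceeds a distortion above
`dMCA`. -/
theorem prob_decoder_le {B s : ℝ} (hd : ∀ x x', 0 ≤ d x x') (hB : ∀ x x', d x x' ≤ B)
    (hB0 : 0 < B) (hs : 0 < s)
    (hW : W ∈ channelTuples X K) {f : (Fin K → X) → X} (hf : IsMCADecoder d p (jointChannel W) f)
    {n : ℕ} (hn : 0 < n) (x : Fin n → X) (hx : l1dist (empirical x) p ≤ s / B) :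
    prob W x {y | dMCA d p (jointChannel W) + 2 * s < ambigDist d (fun i => f (y i)) x} ≤
      B ^ 2 / (n * s ^ 2) := by
  have hJ := isChannel_jointChannel hW
  obtain ⟨τ, hτ⟩ := isMCADecoder_iff.1 hf
  have hw0 : ∀ (i : Fin n) z, 0 ≤ jointChannel W (x i) z := fun i => hJ.1 (x i)
  have hw : ∀ i : Fin n, ∑ z, jointChannel W (x i) z = 1 := fun i => hJ.2 (x i)
  refine le_trans (prodProb_mono hw0 ?_) (prodProb_deviation_le
    (h := fun i z => d (f z) (τ (x i))) hw0 hw (fun _ _ => hd _ _) (fun _ _ => hB _ _) hn hs)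
  intro y hy
  rw [Set.mem_ofPred_eq] at hy ⊢
  have h1 := ambigDist_le d (fun i => f (y i)) x τ
  have h2 := sum_empirical_mul x fun a => ∑ z, jointChannel W a z * d (f z) (τ a)
  have h3 : |∑ a, empirical x a * (∑ z, jointChannel W a z * d (f z) (τ a)) -
      ∑ a, p a * (∑ z, jointChannel W a z * d (f z) (τ a))| ≤ l1dist (empirical x) p * B := by
    refine abs_sum_mul_sub_le fun a => ?_
    obtain ⟨h1, h2⟩ := sum_mul_mem_Icc (hJ.1 a) (hJ.2 a) (fun z => hd (f z) (τ a))
      (fun z => hB (f z) (τ a))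
    rwa [abs_of_nonneg h1]
  rw [← mcaCost_eq d p (jointChannel W), hτ] at h3
  have h4 : l1dist (empirical x) p * B ≤ s := (le_div_iff₀ hB0).1 hx
  have h5 := (abs_le.1 h3).2
  rw [← h2]
  refine le_trans ?_ (le_abs_self _)
  unfold strDist at h1
  linarith

/-- It suffices that the algorithm applies some MCA decoder for `(p, W)` to all columns, except
with small probability; the decoder may depend on the columns, as there are finitely many. -/
theorem achieves_of_isMCADecoder (hd : ∀ x x', 0 ≤ d x x') (hp : p ∈ stdSimplex ℝ X)
    (hW : W ∈ channelTuples X K) {C : Algorithms X K}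
    (hC : ∀ ε : ℝ, 0 < ε → ∃ N : ℕ, ∃ δ : ℝ, 0 < δ ∧ ∀ n : ℕ, N ≤ n → ∀ x : Fin n → X,
      l1dist (empirical x) p ≤ δ →
        prob W x {y | ¬ ∃ f, IsMCADecoder d p (jointChannel W) f ∧ ∀ i, C n y i = f (y i)} < ε)
    {D : ℝ} (hD : dMCA d p (jointChannel W) < D) : Achieves d p W C D := by
  classical
  have hJ := isChannel_jointChannel hW
  refine ⟨(dMCA_nonneg hd hp.1 hJ.1).trans hD.le, fun ε hε => ?_⟩
  obtain ⟨B, hB0, hB⟩ := exists_distortion_bound d hd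
  obtain ⟨s, hs, hDs⟩ : ∃ s, 0 < s ∧ D = dMCA d p (jointChannel W) + 2 * s :=
    ⟨(D - dMCA d p (jointChannel W)) / 2, by linarith, by ring⟩
  obtain ⟨N₁, δ, hδ, h₁⟩ := hC (ε / 2) (by linarith)
  obtain ⟨N₂, hN₂, h₂⟩ := exists_nat_div_mul_sq_lt
    (Fintype.card ((Fin K → X) → X) * B ^ 2) s (half_pos hε)
  refine ⟨max N₁ N₂, min δ (s / B), lt_min hδ (by positivity), fun n hn x hx => ?_⟩
  have hn0 : 0 < n := hN₂.trans_le ((le_max_right _ _).trans hn)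
  have hw0 : ∀ (i : Fin n) z, 0 ≤ jointChannel W (x i) z := fun i => hJ.1 (x i)
  set bad : Set (Fin n → Fin K → X) :=
    {y | ¬ ∃ f, IsMCADecoder d p (jointChannel W) f ∧ ∀ i, C n y i = f (y i)} with hbad
  -- the events that an MCA decoder has a large distortion, whether or not `C` applies it
  let S : ((Fin K → X) → X) → Set (Fin n → Fin K → X) := fun f =>
    if IsMCADecoder d p (jointChannel W) f then {y | D < ambigDist d (fun i => f (y i)) x} else ∅
  have hsub : {y | D < ambigDist d (C n y) x} ⊆ bad ∪ {y | ∃ f, y ∈ S f} := by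
    intro y hy
    by_cases hyb : y ∈ bad
    · exact Or.inl hyb
    · obtain ⟨f, hf, hfy⟩ := not_not.1 hyb
      refine Or.inr ⟨f, ?_⟩
      have : C n y = fun i => f (y i) := funext hfy
      simp only [S, if_pos hf, Set.mem_ofPred_eq]
      rw [← this]
      exact hy
  calc prob W x {y | D < ambigDist d (C n y) x}
      ≤ prob W x bad + ∑ f, prob W x (S f) := by
        refine (prodProb_mono hw0 hsub).trans ((prodProb_union_le hw0 _ _).trans ?_)
        exact add_le_add le_rfl (prodProb_exists_le hw0 S)
    _ ≤ prob W x bad + ∑ _f : (Fin K → X) → X, B ^ 2 / (n * s ^ 2) := by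
        refine add_le_add le_rfl (Finset.sum_le_sum fun f _ => ?_)
        by_cases hf : IsMCADecoder d p (jointChannel W) f
        · simp only [S, if_pos hf]
          rw [hDs]
          exact prob_decoder_le hd hB hB0 hs hW hf hn0 x (hx.trans (min_le_right _ _))
        · simp only [S, if_neg hf, prob, Set.indicator_empty, Finset.sum_const_zero]
          positivity
    _ < ε / 2 + ε / 2 := by
        refine add_lt_add (h₁ n ((le_max_left _ _).trans hn) x (hx.trans (min_le_left _ _))) ?_
        rw [Finset.sum_const, Finset.card_univ, nsmul_eq_mul, ← mul_div_assoc]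
        exact h₂ n ((le_max_right _ _).trans hn)
    _ = ε := by ring

end Achievability

/-! ### The converse -/

section Converse

/-- The posterior distribution of the input of the channel `J`, with prior `p`, given the
output `z`; it is the prior if `z` has probability zero. -/
noncomputable def posterior {X Y : Type*} [Fintype X] (p : X → ℝ) (J : Matrix X Y ℝ) (z : Y)
    (x : X) : ℝ :=
  if ∑ x', p x' * J x' z = 0 then p x else p x * J x z / ∑ x', p x' * J x' z

variable {X Y : Type*} [Fintype X] {p : X → ℝ} {J : Matrix X Y ℝ}

theorem sum_posterior (hp : p ∈ stdSimplex ℝ X) (J : Matrix X Y ℝ) (z : Y) :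
    ∑ x, posterior p J z x = 1 := by
  unfold posterior
  split_ifs with h
  · exact hp.2
  · rw [← Finset.sum_div, div_self h]

/-- The minimal expected distortion, given the output letter `z`, with the original relabelled
by `τ`. -/
noncomputable def bayesCost (d : X → X → ℝ) (p : X → ℝ) (J : Matrix X Y ℝ) (τ : Equiv.Perm X)
    (z : Y) : ℝ :=
  ⨅ c : X, ∑ x, posterior p J z x * d c (τ x)

theorem bayesCost_le (d : X → X → ℝ) (p : X → ℝ) (J : Matrix X Y ℝ) (τ : Equiv.Perm X)
    (z : Y) (c : X) : bayesCost d p J τ z ≤ ∑ x, posterior p J z x * d c (τ x) :=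
  ciInf_le (f := fun c : X => ∑ x, posterior p J z x * d c (τ x))
    (Set.finite_range _).bddBelow c

variable [Fintype Y]

theorem posterior_nonneg (hp : p ∈ stdSimplex ℝ X) (hJ : IsChannel J) (z : Y) (x : X) :
    0 ≤ posterior p J z x := by
  unfold posterior
  split_ifs
  · exact hp.1 x
  · exact div_nonneg (mul_nonneg (hp.1 x) (hJ.1 x z))
      (Finset.sum_nonneg fun x' _ => mul_nonneg (hp.1 x') (hJ.1 x' z))

theorem sum_mul_posterior (hp : p ∈ stdSimplex ℝ X) (hJ : IsChannel J) (z : Y) (x : X) :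
    (∑ x', p x' * J x' z) * posterior p J z x = p x * J x z := by
  unfold posterior
  split_ifs with h
  · rw [h, zero_mul]
    exact ((Finset.sum_eq_zero_iff_of_nonneg fun x' _ =>
      mul_nonneg (hp.1 x') (hJ.1 x' z)).1 h x (Finset.mem_univ x)).symm
  · rw [mul_div_cancel₀ _ h]

/-- Two ways to draw a pair of strings: the original first, or the output first. -/
theorem sum_prior_eq_sum_posterior (hp : p ∈ stdSimplex ℝ X) (hJ : IsChannel J) {n : ℕ}
    (E : (Fin n → X) → (Fin n → Y) → Prop) :
    ∑ x : Fin n → X, (∏ i, p (x i)) * prodProb (fun i => J (x i)) {y | E x y} =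
      ∑ y : Fin n → Y, (∏ i, ∑ x, p x * J x (y i)) *
        prodProb (fun i => posterior p J (y i)) {x | E x y} := by
  classical
  unfold prodProb
  simp_rw [Finset.mul_sum]
  rw [Finset.sum_comm]
  refine Finset.sum_congr rfl fun y _ => Finset.sum_congr rfl fun x _ => ?_
  simp only [Set.indicator_apply, Set.mem_ofPred_eq]
  split_ifs
  · rw [← Finset.prod_mul_distrib, ← Finset.prod_mul_distrib]
    exact Finset.prod_congr rfl fun i _ => (sum_mul_posterior hp hJ _ _).symm
  · simp

variable [DecidableEq X] {d : X → X → ℝ}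

theorem dMCA_le_sum_bayesCost [Nonempty X] (hp : p ∈ stdSimplex ℝ X) (hJ : IsChannel J)
    (τ : Equiv.Perm X) :
    dMCA d p J ≤ ∑ z, (∑ x, p x * J x z) * bayesCost d p J τ z := by
  have h : ∀ z, ∃ c, ∑ x, posterior p J z x * d c (τ x) = bayesCost d p J τ z := fun z =>
    exists_eq_ciInf_of_finite
  choose f hf using h
  refine (dMCA_le d p J τ f).trans (le_of_eq ?_)
  rw [mcaCost_eq]
  simp_rw [← hf, Finset.mul_sum]
  rw [Finset.sum_comm]
  refine Finset.sum_congr rfl fun z _ => Finset.sum_congr rfl fun x _ => ?_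
  rw [← mul_assoc, ← mul_assoc, sum_mul_posterior hp hJ]

/-- If the letters of the original are drawn independently from `p`, any estimate of the original
relabelled by the fixed permutation `τ` has a distortion at least about `dMCA`, except with small
probability: given the output, the letters of the original are independent with the posterior
distributions. -/
theorem sum_prior_mul_prob_le [Nonempty X] {B s : ℝ} (hd : ∀ x x', 0 ≤ d x x')
    (hB : ∀ x x', d x x' ≤ B)
    (hs : 0 < s) (hp : p ∈ stdSimplex ℝ X) (hJ : IsChannel J) {n : ℕ} (hn : 0 < n)
    (c : (Fin n → Y) → Fin n → X) (τ : Equiv.Perm X) :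
    ∑ x : Fin n → X, (∏ i, p (x i)) * prodProb (fun i => J (x i))
        {y | strDist d (c y) (fun i => τ (x i)) ≤ dMCA d p J - 2 * s} ≤
      2 * (B ^ 2 / (n * s ^ 2)) := by
  set q : Y → ℝ := fun z => ∑ x, p x * J x z with hq
  have hq0 : ∀ z, 0 ≤ q z := fun z => Finset.sum_nonneg fun x _ => mul_nonneg (hp.1 x) (hJ.1 x z)
  have hq1 : ∑ z, q z = 1 := by
    simp only [hq]
    rw [Finset.sum_comm]
    simp [← Finset.mul_sum, hJ.2, hp.2]
  set g := bayesCost d p J τ with hg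
  have hg0 : ∀ z, 0 ≤ g z := fun z => Real.iInf_nonneg fun c =>
    Finset.sum_nonneg fun x _ => mul_nonneg (posterior_nonneg hp hJ z x) (hd _ _)
  have hgB : ∀ z, g z ≤ B := fun z => (bayesCost_le d p J τ z (Classical.arbitrary X)).trans
    (sum_mul_mem_Icc (posterior_nonneg hp hJ z) (sum_posterior hp J z)
      (fun x => hd (Classical.arbitrary X) (τ x)) (fun x => hB (Classical.arbitrary X) (τ x))).2
  have hn' : (0 : ℝ) < n := by exact_mod_cast hn
  refine (sum_prior_eq_sum_posterior hp hJ
    fun x y => strDist d (c y) (fun i => τ (x i)) ≤ dMCA d p J - 2 * s).trans_le ?_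
  -- the outputs whose average Bayes cost is atypically small
  set T : Set (Fin n → Y) :=
    {y | s ≤ |(∑ i, g (y i)) / n - (∑ _i : Fin n, ∑ z, q z * g z) / n|} with hT
  have hTle : prodProb (fun _ : Fin n => q) T ≤ B ^ 2 / (n * s ^ 2) :=
    prodProb_deviation_le (w := fun _ : Fin n => q) (h := fun _ => g) (fun _ => hq0)
      (fun _ => hq1) (fun _ => hg0) (fun _ => hgB) hn hs
  have hone : ∑ y : Fin n → Y, ∏ i, q (y i) = 1 := by
    rw [sum_prod_apply fun (_ : Fin n) z => q z]
    simp [hq1]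
  have hpoint : ∀ y : Fin n → Y, (∏ i, q (y i)) * prodProb (fun i => posterior p J (y i))
        {x | strDist d (c y) (fun i => τ (x i)) ≤ dMCA d p J - 2 * s} ≤
      T.indicator (fun y => ∏ i, q (y i)) y + (∏ i, q (y i)) * (B ^ 2 / (n * s ^ 2)) := by
    intro y
    have hpr : 0 ≤ ∏ i, q (y i) := Finset.prod_nonneg fun i _ => hq0 _
    have hw0 : ∀ (i : Fin n) x, 0 ≤ posterior p J (y i) x := fun i => posterior_nonneg hp hJ (y i)
    have hw1 : ∀ i : Fin n, ∑ x, posterior p J (y i) x = 1 := fun i => sum_posterior hp J (y i)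
    by_cases hy : y ∈ T
    · rw [Set.indicator_of_mem hy]
      have h1 : prodProb (fun i => posterior p J (y i))
          {x | strDist d (c y) (fun i => τ (x i)) ≤ dMCA d p J - 2 * s} ≤ 1 := by
        rw [← prodProb_add_compl hw1
          {x | strDist d (c y) (fun i => τ (x i)) ≤ dMCA d p J - 2 * s}]
        linarith [prodProb_nonneg hw0
          {x | strDist d (c y) (fun i => τ (x i)) ≤ dMCA d p J - 2 * s}ᶜ]
      have h2 : 0 ≤ (∏ i, q (y i)) * (B ^ 2 / (n * s ^ 2)) := by positivity
      linarith [mul_le_mul_of_nonneg_left h1 hpr]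
    · rw [Set.indicator_of_notMem hy, zero_add]
      refine mul_le_mul_of_nonneg_left ?_ hpr
      refine (prodProb_mono hw0 ?_).trans (prodProb_deviation_le
        (h := fun i x => d (c y i) (τ x)) hw0 hw1 (fun _ _ => hd _ _) (fun _ _ => hB _ _) hn hs)
      intro x hx
      rw [Set.mem_ofPred_eq] at hx ⊢
      rw [hT, Set.mem_ofPred_eq, not_le] at hy
      have h1 : dMCA d p J ≤ (∑ _i : Fin n, ∑ z, q z * g z) / n := by
        rw [Finset.sum_const, Finset.card_univ, Fintype.card_fin, nsmul_eq_mul,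
          mul_div_cancel_left₀ _ hn'.ne']
        exact dMCA_le_sum_bayesCost hp hJ τ
      have h2 : (∑ i, g (y i)) / n ≤
          (∑ i, ∑ x, posterior p J (y i) x * d (c y i) (τ x)) / n :=
        div_le_div_of_nonneg_right
          (Finset.sum_le_sum fun i _ => bayesCost_le d p J τ (y i) (c y i)) hn'.le
      have h3 := (abs_lt.1 hy).1
      unfold strDist at hx
      rw [abs_sub_comm]
      refine le_trans ?_ (le_abs_self _)
      linarith
  calc _ ≤ ∑ y : Fin n → Y, (T.indicator (fun y => ∏ i, q (y i)) y +
        (∏ i, q (y i)) * (B ^ 2 / (n * s ^ 2))) := Finset.sum_le_sum fun y _ => hpoint y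
    _ = prodProb (fun _ : Fin n => q) T + B ^ 2 / (n * s ^ 2) := by
        rw [Finset.sum_add_distrib, ← Finset.sum_mul, hone, one_mul]
        rfl
    _ ≤ _ := by linarith

end Converse

section Resolution

variable {X : Type*} [Fintype X] [DecidableEq X] {K : ℕ} {d : X → X → ℝ}
  {p : X → ℝ} {W : Fin K → Matrix X X ℝ}

theorem exists_strDist_le {X : Type*} [Finite X] {d : X → X → ℝ} {n : ℕ}
    {xhat x : Fin n → X} {D : ℝ} (h : ambigDist d xhat x ≤ D) :
    ∃ τ : Equiv.Perm X, strDist d xhat (fun i => τ (x i)) ≤ D := by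
  obtain ⟨τ, hτ⟩ := exists_eq_ciInf_of_finite
    (f := fun τ : Equiv.Perm X => strDist d xhat fun i => τ (x i))
  exact ⟨τ, hτ.le.trans h⟩

/-- No algorithm does better than `dMCA`, even if it knows the channels and the type: otherwise it
would do so on average over random originals with independent letters, whose type is close
to `p`. -/
theorem dMCA_le_of_achieves [Nonempty X] (hd : ∀ x x', 0 ≤ d x x') (hp : p ∈ stdSimplex ℝ X)
    (hW : W ∈ channelTuples X K) {C : Algorithms X K} {D : ℝ} (h : Achieves d p W C D) :
    dMCA d p (jointChannel W) ≤ D := by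
  classical
  by_contra! hlt
  have hJ := isChannel_jointChannel hW
  obtain ⟨B, -, hB⟩ := exists_distortion_bound d hd
  obtain ⟨s, hs, hDs⟩ : ∃ s, 0 < s ∧ D = dMCA d p (jointChannel W) - 2 * s :=
    ⟨(dMCA d p (jointChannel W) - D) / 2, by linarith, by ring⟩
  obtain ⟨N, δ, hδ, hN⟩ := h.2 (1 / 2) (by norm_num)
  obtain ⟨N₁, hN₁, h₁⟩ := exists_nat_div_mul_sq_lt ((Fintype.card X : ℝ) ^ 3) δ
    (show (0 : ℝ) < 1 / 4 by norm_num)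
  obtain ⟨N₂, hN₂, h₂⟩ := exists_nat_div_mul_sq_lt
    (Fintype.card (Equiv.Perm X) * 2 * B ^ 2) s (show (0 : ℝ) < 1 / 4 by norm_num)
  set n := max N (max N₁ N₂) with hn
  have hnN : N ≤ n := le_max_left _ _
  have hnN₁ : N₁ ≤ n := (le_max_left _ _).trans (le_max_right _ _)
  have hnN₂ : N₂ ≤ n := (le_max_right _ _).trans (le_max_right _ _)
  have hn0 : 0 < n := hN₁.trans_le hnN₁
  have hn' : (n : ℝ) ≠ 0 := by exact_mod_cast hn0.ne'
  have hpr : ∀ x : Fin n → X, 0 ≤ ∏ i, p (x i) := fun x => Finset.prod_nonneg fun i _ => hp.1 _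
  have hone : ∑ x : Fin n → X, ∏ i, p (x i) = 1 := by
    rw [sum_prod_apply fun (_ : Fin n) x => p x]
    simp [hp.2]
  set far : Set (Fin n → X) := {x | δ < l1dist (empirical x) p} with hfar
  have hfarle : prodProb (fun _ : Fin n => p) far < 1 / 4 := by
    have := prodProb_l1dist_empirical_le (w := fun _ : Fin n => p) (fun _ => hp.1)
      (fun _ => hp.2) hn0 hδ
    simp only [Finset.sum_const, Finset.card_univ, Fintype.card_fin, nsmul_eq_mul,
      mul_div_cancel_left₀ _ hn'] at this
    exact this.trans_lt (h₁ n hnN₁)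
  -- the average failure probability is at most `1 / 2 + 1 / 4`
  have hfail : ∑ x : Fin n → X, (∏ i, p (x i)) * prob W x {y | D < ambigDist d (C n y) x} ≤
      1 / 2 + prodProb (fun _ : Fin n => p) far := by
    calc _ ≤ ∑ x : Fin n → X, ((∏ i, p (x i)) * (1 / 2) +
          far.indicator (fun x => ∏ i, p (x i)) x) := by
          refine Finset.sum_le_sum fun x _ => ?_
          by_cases hx : x ∈ far
          · rw [Set.indicator_of_mem hx]
            have h1 : prob W x {y | D < ambigDist d (C n y) x} ≤ 1 := by
              have := prodProb_add_compl (w := fun i => jointChannel W (x i))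
                (fun i => hJ.2 (x i)) {y | D < ambigDist d (C n y) x}
              have h2 := prodProb_nonneg (w := fun i => jointChannel W (x i))
                (fun i => hJ.1 (x i)) {y | D < ambigDist d (C n y) x}ᶜ
              change prodProb (fun i => jointChannel W (x i)) _ ≤ 1
              linarith
            nlinarith [hpr x, mul_le_mul_of_nonneg_left h1 (hpr x)]
          · rw [Set.indicator_of_notMem hx, add_zero]
            exact mul_le_mul_of_nonneg_left (hN n hnN x (not_lt.1 hx)).le (hpr x)
      _ = _ := by
          rw [Finset.sum_add_distrib, ← Finset.sum_mul, hone, one_mul]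
          rfl
  -- the average success probability is at most `1 / 4`
  have hsucc : ∑ x : Fin n → X, (∏ i, p (x i)) * prob W x {y | D < ambigDist d (C n y) x}ᶜ <
      1 / 4 := by
    calc _ ≤ ∑ x : Fin n → X, ∑ τ : Equiv.Perm X, (∏ i, p (x i)) *
          prodProb (fun i => jointChannel W (x i))
            {y | strDist d (C n y) (fun i => τ (x i)) ≤ dMCA d p (jointChannel W) - 2 * s} := by
          refine Finset.sum_le_sum fun x _ => ?_
          rw [← Finset.mul_sum]
          refine mul_le_mul_of_nonneg_left ?_ (hpr x)
          refine le_trans (prodProb_mono (fun i => hJ.1 (x i)) fun y hy => ?_)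
            (prodProb_exists_le (fun i => hJ.1 (x i)) _)
          rw [← hDs]
          exact exists_strDist_le (not_lt.1 hy)
      _ ≤ ∑ _τ : Equiv.Perm X, 2 * (B ^ 2 / (n * s ^ 2)) := by
          rw [Finset.sum_comm]
          exact Finset.sum_le_sum fun τ _ => sum_prior_mul_prob_le hd hB hs hp hJ hn0 (C n) τ
      _ = Fintype.card (Equiv.Perm X) * 2 * B ^ 2 / (n * s ^ 2) := by
          rw [Finset.sum_const, Finset.card_univ, nsmul_eq_mul]
          ring
      _ < 1 / 4 := h₂ n hnN₂
  have htotal : ∑ x : Fin n → X, (∏ i, p (x i)) * prob W x {y | D < ambigDist d (C n y) x} +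
      ∑ x : Fin n → X, (∏ i, p (x i)) * prob W x {y | D < ambigDist d (C n y) x}ᶜ = 1 := by
    rw [← Finset.sum_add_distrib, ← hone]
    refine Finset.sum_congr rfl fun x _ => ?_
    have := prodProb_add_compl (w := fun i => jointChannel W (x i))
      (fun i => hJ.2 (x i)) {y | D < ambigDist d (C n y) x}
    rw [← mul_add]
    exact (congrArg _ this).trans (mul_one _)
  linarith

theorem resolution_eq_dMCA [Nonempty X] (hd : ∀ x x', 0 ≤ d x x') (hp : p ∈ stdSimplex ℝ X)
    (hW : W ∈ channelTuples X K) : resolution d p W = dMCA d p (jointChannel W) := by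
  obtain ⟨f, hf⟩ := exists_isMCADecoder d p (jointChannel W)
  have hach : ∀ D, dMCA d p (jointChannel W) < D →
      D ∈ {D : ℝ | ∃ C : Algorithms X K, Achieves d p W C D} := fun D hD =>
    ⟨fun _ y i => f (y i), achieves_of_isMCADecoder hd hp hW (fun ε hε =>
      ⟨0, 1, one_pos, fun n _ x _ => by
        have : {y : Fin n → Fin K → X | ¬ ∃ f', IsMCADecoder d p (jointChannel W) f' ∧
            ∀ i, f (y i) = f' (y i)} = ∅ := by
          ext y
          simpa using ⟨f, hf, fun _ => rfl⟩
        rw [this]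
        simpa [prob] using hε⟩) hD⟩
  have hbdd : BddBelow {D : ℝ | ∃ C : Algorithms X K, Achieves d p W C D} :=
    ⟨0, fun D ⟨_, hC⟩ => hC.1⟩
  refine le_antisymm (le_of_forall_gt_imp_ge_of_dense fun D hD => csInf_le hbdd (hach D hD)) ?_
  exact le_csInf ⟨_, hach _ (lt_add_one _)⟩ fun D ⟨_, hC⟩ => dMCA_le_of_achieves hd hp hW hC

end Resolution

/-! ### Identifiability -/

section Identifiability

open Matrix

theorem IsChannel.mulVec_one {X Y : Type*} [Fintype Y] {U : Matrix X Y ℝ} (hU : IsChannel U) :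
    U *ᵥ 1 = 1 := by
  funext x
  simp [mulVec, dotProduct, hU.2 x]

variable {X : Type*} [Fintype X] {K : ℕ} {p r : X → ℝ} {V W : Fin K → Matrix X X ℝ}

theorem sum_outputDist_mul_prod (r : X → ℝ) (V : Fin K → Matrix X X ℝ) (g : Fin K → X → ℝ) :
    ∑ z, outputDist r V z * ∏ j, g j (z j) = ∑ x, r x * ∏ j, (V j *ᵥ g j) x := by
  unfold outputDist jointChannel
  simp_rw [Finset.sum_mul]
  rw [Finset.sum_comm]
  refine Finset.sum_congr rfl fun x _ => ?_
  simp_rw [mul_assoc, ← Finset.mul_sum, ← Finset.prod_mul_distrib]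
  rw [sum_prod_apply fun j a => V j x a * g j a]
  rfl

/-- The marginal of the output distribution at three channels, in the form of a trilinear
functional. -/
theorem sum_mulVec_mul_mulVec_mul_mulVec (hW : W ∈ channelTuples X K)
    (hV : V ∈ channelTuples X K) (h : outputDist r V = outputDist p W) {i₀ i₁ j : Fin K}
    (h01 : i₀ ≠ i₁) (h0j : j ≠ i₀) (h1j : j ≠ i₁) (u v g : X → ℝ) :
    ∑ x, r x * ((V i₀ *ᵥ u) x * (V i₁ *ᵥ v) x * (V j *ᵥ g) x) =
      ∑ x, p x * ((W i₀ *ᵥ u) x * (W i₁ *ᵥ v) x * (W j *ᵥ g) x) := by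
  let G : Fin K → X → ℝ := fun k => if k = i₀ then u else if k = i₁ then v else
    if k = j then g else 1
  have key : ∀ U ∈ channelTuples X K, ∀ x, ∏ k, (U k *ᵥ G k) x =
      (U i₀ *ᵥ u) x * (U i₁ *ᵥ v) x * (U j *ᵥ g) x := by
    intro U hU x
    have : ∀ k, (U k *ᵥ G k) x = (if k = i₀ then (U k *ᵥ u) x else 1) *
        (if k = i₁ then (U k *ᵥ v) x else 1) * (if k = j then (U k *ᵥ g) x else 1) := by
      intro k
      by_cases k0 : k = i₀
      · subst k0
        simp [G, h01, h0j.symm]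
      by_cases k1 : k = i₁
      · subst k1
        simp [G, k0, h1j.symm]
      by_cases kj : k = j
      · subst kj
        simp [G, k0, k1]
      · simp [G, k0, k1, kj, (hU k).mulVec_one]
    rw [Finset.prod_congr rfl fun k _ => this k, Finset.prod_mul_distrib,
      Finset.prod_mul_distrib]
    simp
  have h1 := sum_outputDist_mul_prod r V G
  rw [h, sum_outputDist_mul_prod p W G] at h1
  simp_rw [key V hV, key W hW] at h1
  exact h1.symm

theorem exists_ne_ne (hK : 3 ≤ K) (i j : Fin K) : ∃ k, k ≠ i ∧ k ≠ j := by
  have h : ({i, j} : Finset (Fin K)).card < (Finset.univ : Finset (Fin K)).card := by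
    have := Finset.card_le_two (a := i) (b := j)
    rw [Finset.card_univ, Fintype.card_fin]
    omega
  obtain ⟨k, -, hk⟩ := Finset.exists_mem_notMem_of_card_lt_card h
  exact ⟨k, by simpa [not_or] using hk⟩

variable [DecidableEq X]

/-- If a strictly positive distribution and invertible channels have the same output
distribution as `(r, V)`, then the channels `V` are invertible as well: the joint law of two
columns, as a matrix, is invertible. -/
theorem mem_invertibleTuples_of_outputDist_eq (hK : 3 ≤ K) (hp : ∀ x, p x ≠ 0)
    (hW : W ∈ invertibleTuples X K) (hV : V ∈ channelTuples X K)
    (h : outputDist r V = outputDist p W) : V ∈ invertibleTuples X K := by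
  intro i₀
  refine ⟨hV i₀, ?_⟩
  obtain ⟨i₁, h10, -⟩ := exists_ne_ne hK i₀ i₀
  obtain ⟨j, hj0, hj1⟩ := exists_ne_ne hK i₀ i₁
  rw [← mulVec_injective_iff_isUnit]
  have h0 : ∀ u, V i₀ *ᵥ u = 0 → u = 0 := by
    intro u hu
    have hWu : W i₀ *ᵥ u = 0 := by
      funext x
      have h1 := sum_mulVec_mul_mulVec_mul_mulVec (invertibleTuples_subset hW) hV h
        h10.symm hj0 hj1 u ((W i₁)⁻¹ *ᵥ Pi.single x 1) 1
      have hv : W i₁ *ᵥ ((W i₁)⁻¹ *ᵥ Pi.single x 1) = Pi.single x 1 := by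
        rw [mulVec_mulVec, mul_nonsing_inv _ ((isUnit_iff_isUnit_det _).1 (hW i₁).2), one_mulVec]
      rw [hu, hv, (hW j).1.mulVec_one] at h1
      simp [Pi.single_apply, hp] at h1
      simpa using h1
    exact mulVec_injective_iff_isUnit.2 (hW i₀).2 (hWu.trans (mulVec_zero _).symm)
  intro u v huv
  have := h0 (u - v) (by rw [mulVec_sub]; exact sub_eq_zero.2 huv)
  exact sub_eq_zero.1 this

theorem exists_perm_apply_ne_zero {A : Matrix X X ℝ} (hA : IsUnit A) :
    ∃ π : Equiv.Perm X, ∀ x, A x (π x) ≠ 0 := by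
  have hdet : Aᵀ.det ≠ 0 := by
    rw [det_transpose]
    exact ((isUnit_iff_isUnit_det A).1 hA).ne_zero
  rw [det_apply'] at hdet
  obtain ⟨π, -, hπ⟩ := Finset.exists_ne_zero_of_sum_ne_zero hdet
  exact ⟨π, fun x => Finset.prod_ne_zero_iff.1 (right_ne_zero_of_mul hπ) x (Finset.mem_univ x)⟩

/-- Two systems with invertible channels and the same output distribution agree up to a
permutation of the inputs, except for the rows of the channels at inputs of probability zero.
Testing the output distribution against a column of the inverse of one channel of `V` and a
column of the inverse of another channel of `W` isolates one input on either side. -/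
theorem exists_perm_of_outputDist_eq (hK : 3 ≤ K) (hW : W ∈ invertibleTuples X K)
    (hV : V ∈ invertibleTuples X K) (h : outputDist r V = outputDist p W) :
    ∃ π : Equiv.Perm X, (∀ x, r (π x) = p x) ∧ ∀ x, p x ≠ 0 → ∀ j, V j (π x) = W j x := by
  have hW' := invertibleTuples_subset hW
  have hV' := invertibleTuples_subset hV
  have hdetV := fun j => (isUnit_iff_isUnit_det _).1 (hV j).2
  have hdetW := fun j => (isUnit_iff_isUnit_det _).1 (hW j).2
  set i₀ : Fin K := ⟨0, by omega⟩ with hi₀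
  obtain ⟨i₁, h10, -⟩ := exists_ne_ne hK i₀ i₀
  -- the aim is that, on the inputs of positive probability, `A` and `T` are inverse permutations
  set A : Matrix X X ℝ := W i₀ * (V i₀)⁻¹ with hA
  set T : Matrix X X ℝ := V i₁ * (W i₁)⁻¹ with hT
  have hAV : A * V i₀ = W i₀ := by rw [hA, nonsing_inv_mul_cancel_right _ _ (hdetV i₀)]
  have hTW : T * W i₁ = V i₁ := by rw [hT, nonsing_inv_mul_cancel_right _ _ (hdetW i₁)]
  have hA1 : ∀ x, ∑ x', A x x' = 1 := by
    have : A *ᵥ 1 = 1 := by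
      rw [← (hV' i₀).mulVec_one, mulVec_mulVec, hAV, (hW' i₀).mulVec_one, (hV' i₀).mulVec_one]
    intro x
    simpa [mulVec, dotProduct] using congrFun this x
  have hT1 : ∀ x, ∑ x', T x x' = 1 := by
    have : T *ᵥ 1 = 1 := by
      rw [← (hW' i₁).mulVec_one, mulVec_mulVec, hTW, (hV' i₁).mulVec_one, (hW' i₁).mulVec_one]
    intro x
    simpa [mulVec, dotProduct] using congrFun this x
  have key : ∀ j, j ≠ i₀ → j ≠ i₁ → ∀ x x' g,
      r x' * (T x' x * (V j *ᵥ g) x') = p x * (A x x' * (W j *ᵥ g) x) := by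
    intro j hj0 hj1 x x' g
    have h1 := sum_mulVec_mul_mulVec_mul_mulVec hW' hV' h h10.symm hj0 hj1
      ((V i₀)⁻¹ *ᵥ Pi.single x' 1) ((W i₁)⁻¹ *ᵥ Pi.single x 1) g
    simp only [mulVec_mulVec, mul_nonsing_inv _ (hdetV i₀), mul_nonsing_inv _ (hdetW i₁),
      one_mulVec, ← hA, ← hT] at h1
    simp only [mulVec_single_one] at h1
    simpa [Pi.single_apply, Matrix.col_apply] using h1
  have key1 : ∀ x x', r x' * T x' x = p x * A x x' := by
    intro x x'
    obtain ⟨j, hj0, hj1⟩ := exists_ne_ne hK i₀ i₁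
    simpa [(hV' j).mulVec_one, (hW' j).mulVec_one] using key j hj0 hj1 x x' 1
  have hrow : ∀ j, j ≠ i₀ → j ≠ i₁ → ∀ x x', p x ≠ 0 → A x x' ≠ 0 → V j x' = W j x := by
    intro j hj0 hj1 x x' hpx hAx
    funext c
    have h1 := key j hj0 hj1 x x' (Pi.single c 1)
    rw [← mul_assoc, ← mul_assoc, key1] at h1
    have := mul_left_cancel₀ (mul_ne_zero hpx hAx) h1
    simpa using this
  have hAu : IsUnit A := by
    refine (hW i₀).2.mul ?_
    rw [isUnit_nonsing_inv_iff]
    exact (hV i₀).2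
  obtain ⟨π, hπ⟩ := exists_perm_apply_ne_zero hAu
  have hA0 : ∀ x, p x ≠ 0 → ∀ x', x' ≠ π x → A x x' = 0 := by
    intro x hpx x' hx'
    by_contra hAx
    obtain ⟨j, hj0, hj1⟩ := exists_ne_ne hK i₀ i₁
    exact hx' ((linearIndependent_rows_of_isUnit (hV j).2).injective
      ((hrow j hj0 hj1 x x' hpx hAx).trans (hrow j hj0 hj1 x (π x) hpx (hπ x)).symm))
  have hA2 : ∀ x, p x ≠ 0 → A x (π x) = 1 := by
    intro x hpx
    rw [← hA1 x]
    exact (Finset.sum_eq_single (π x) (fun x' _ hx' => hA0 x hpx x' hx') (by simp)).symm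
  have hpA : ∀ x y, y ≠ x → p y * A y (π x) = 0 := by
    intro x y hyx
    by_cases hpy : p y = 0
    · rw [hpy, zero_mul]
    · rw [hA0 y hpy (π x) (fun hc => hyx (π.injective hc).symm), mul_zero]
  have hr : ∀ x, r (π x) = p x := by
    intro x
    calc r (π x) = ∑ y, r (π x) * T (π x) y := by rw [← Finset.mul_sum, hT1, mul_one]
      _ = ∑ y, p y * A y (π x) := Finset.sum_congr rfl fun y _ => key1 y (π x)
      _ = p x * A x (π x) := Finset.sum_eq_single x (fun y _ hy => hpA x y hy) (by simp)
      _ = p x := by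
        by_cases hpx : p x = 0
        · rw [hpx, zero_mul]
        · rw [hA2 x hpx, mul_one]
  refine ⟨π, hr, fun x hpx j => ?_⟩
  by_cases hj0 : j = i₀
  · rw [hj0]
    funext c
    rw [← hAV, mul_apply, Finset.sum_eq_single (π x)
      (fun y _ hy => by rw [hA0 x hpx y hy, zero_mul]) (by simp), hA2 x hpx, one_mul]
  by_cases hj1 : j = i₁
  · have hT0 : ∀ y, y ≠ x → T (π x) y = 0 := by
      intro y hy
      have := (key1 y (π x)).trans (hpA x y hy)
      rw [hr] at this
      exact (mul_eq_zero.1 this).resolve_left hpx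
    have hT2 : T (π x) x = 1 := by
      rw [← hT1 (π x)]
      exact (Finset.sum_eq_single x (fun y _ hy => hT0 y hy) (by simp)).symm
    rw [hj1]
    funext c
    rw [← hTW, mul_apply, Finset.sum_eq_single x
      (fun y _ hy => by rw [hT0 y hy, zero_mul]) (by simp), hT2, one_mul]
  · exact hrow j hj0 hj1 x (π x) hpx (hπ x)

/-- Systems with invertible channels and the same output distribution have the same MCA
decoders. -/
theorem IsMCADecoder.of_outputDist_eq {d : X → X → ℝ} (hK : 3 ≤ K)
    (hW : W ∈ invertibleTuples X K) (hV : V ∈ invertibleTuples X K)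
    (h : outputDist r V = outputDist p W) {f : (Fin K → X) → X}
    (hf : IsMCADecoder d r (jointChannel V) f) : IsMCADecoder d p (jointChannel W) f := by
  obtain ⟨π, hr, hVW⟩ := exists_perm_of_outputDist_eq hK hW hV h
  have hcost : ∀ τ f, mcaCost d p (jointChannel W) (π.trans τ) f =
      mcaCost d r (jointChannel V) τ f := by
    intro τ f
    rw [mcaCost_eq, mcaCost_eq, ← Equiv.sum_comp π fun x => r x * _]
    refine Finset.sum_congr rfl fun x _ => ?_
    rw [hr]
    by_cases hpx : p x = 0
    · rw [hpx, zero_mul, zero_mul]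
    · have : ∀ z, jointChannel V (π x) z = jointChannel W x z := fun z =>
        Finset.prod_congr rfl fun j _ => by rw [hVW x hpx j]
      simp_rw [this]
      rfl
  obtain ⟨τ, hτ⟩ := hf
  refine ⟨π.trans τ, fun τ' f' => ?_⟩
  have := hτ (π.symm.trans τ') f'
  rwa [← hcost, ← hcost, ← Equiv.trans_assoc, Equiv.self_trans_symm, Equiv.refl_trans] at this

end Identifiability

/-! ### Approximate fits -/

section Fits

theorem continuous_jointChannel {X : Type*} {K : ℕ} (x : X) (z : Fin K → X) :
    Continuous fun c : (X → ℝ) × (Fin K → Matrix X X ℝ) => jointChannel c.2 x z := by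
  unfold jointChannel
  exact continuous_finsetProd _ fun j _ => Continuous.matrix_elem (by fun_prop) _ _

variable {X : Type*} [Fintype X] {K : ℕ}

theorem continuous_l1dist_outputDist (q : (Fin K → X) → ℝ) :
    Continuous fun c : (X → ℝ) × (Fin K → Matrix X X ℝ) => l1dist (outputDist c.1 c.2) q := by
  unfold l1dist outputDist
  have := continuous_jointChannel (X := X) (K := K)
  fun_prop

theorem continuous_mcaCost [DecidableEq X] (d : X → X → ℝ) (τ : Equiv.Perm X)
    (f : (Fin K → X) → X) :
    Continuous fun c : (X → ℝ) × (Fin K → Matrix X X ℝ) =>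
      mcaCost d c.1 (jointChannel c.2) τ f := by
  unfold mcaCost
  have := continuous_jointChannel (X := X) (K := K)
  fun_prop

theorem isClosed_setOf_isMCADecoder [DecidableEq X] (d : X → X → ℝ) (f : (Fin K → X) → X) :
    IsClosed {c : (X → ℝ) × (Fin K → Matrix X X ℝ) |
      IsMCADecoder d c.1 (jointChannel c.2) f} := by
  have : {c : (X → ℝ) × (Fin K → Matrix X X ℝ) | IsMCADecoder d c.1 (jointChannel c.2) f} =
      ⋃ τ : Equiv.Perm X, ⋂ (τ' : Equiv.Perm X) (f' : (Fin K → X) → X),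
        {c | mcaCost d c.1 (jointChannel c.2) τ f ≤ mcaCost d c.1 (jointChannel c.2) τ' f'} := by
    ext c
    simp [IsMCADecoder]
  rw [this]
  exact isClosed_iUnion_of_finite fun τ => isClosed_iInter fun τ' => isClosed_iInter fun f' =>
    isClosed_le (continuous_mcaCost d τ f) (continuous_mcaCost d τ' f')

theorem isCompact_channelTuples : IsCompact (channelTuples X K) := by
  have : channelTuples X K = Set.univ.pi fun _ : Fin K => Set.univ.pi fun _ : X =>
      stdSimplex ℝ X := by
    ext W
    exact ⟨fun h j _ x _ => ⟨(h j).1 x, (h j).2 x⟩,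
      fun h j => ⟨fun x => (h j trivial x trivial).1, fun x => (h j trivial x trivial).2⟩⟩
  rw [this]
  exact isCompact_univ_pi fun _ => isCompact_univ_pi fun _ => isCompact_stdSimplex ℝ X

theorem isCompact_dcaCandidates (K : ℕ) (e : X ≃ Fin (Fintype.card X)) :
    IsCompact (dcaCandidates K e) := by
  have : dcaCandidates K e = (stdSimplex ℝ X ×ˢ channelTuples X K) ∩
      ⋂ (x : X) (x' : X) (_ : e x ≤ e x'), {c | c.1 x' ≤ c.1 x} := by
    ext c
    simp only [dcaCandidates, Set.mem_ofPred_eq, Set.mem_inter_iff, Set.mem_prod, Set.mem_iInter]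
    tauto
  rw [this]
  refine ((isCompact_stdSimplex ℝ X).prod isCompact_channelTuples).inter_right ?_
  exact isClosed_iInter fun x => isClosed_iInter fun x' => isClosed_iInter fun _ =>
    isClosed_le (by fun_prop) (by fun_prop)

theorem isCompact_setOf_isDCAFit (e : X ≃ Fin (Fintype.card X)) (η : ℝ)
    (q : (Fin K → X) → ℝ) :
    IsCompact {c : (X → ℝ) × (Fin K → Matrix X X ℝ) | IsDCAFit e η q c.1 c.2} := by
  have : {c : (X → ℝ) × (Fin K → Matrix X X ℝ) | IsDCAFit e η q c.1 c.2} = dcaCandidates K e ∩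
      ⋂ c' ∈ dcaCandidates K e,
        {c | l1dist (outputDist c.1 c.2) q ≤ l1dist (outputDist c'.1 c'.2) q + η} := by
    ext c
    simp [IsDCAFit]
  rw [this]
  exact (isCompact_dcaCandidates K e).inter_right (isClosed_biInter fun c' _ =>
    isClosed_le (continuous_l1dist_outputDist q) continuous_const)

variable [DecidableEq X]

/-- Every system can be relabelled into a candidate of the fit. -/
theorem exists_mem_dcaCandidates (e : X ≃ Fin (Fintype.card X)) {p : X → ℝ}
    (hp : p ∈ stdSimplex ℝ X) {W : Fin K → Matrix X X ℝ} (hW : W ∈ channelTuples X K) :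
    ∃ c ∈ dcaCandidates K e, outputDist c.1 c.2 = outputDist p W ∧
      |∏ j, (c.2 j).det| = |∏ j, (W j).det| := by
  -- `ρ` sorts the values of `p` in non-increasing order
  let ρ := Tuple.sort fun i => -p (e.symm i)
  have hρ : Monotone ((fun i => -p (e.symm i)) ∘ ρ) := Tuple.monotone_sort _
  let σ : Equiv.Perm X := (e.trans ρ).trans e.symm
  refine ⟨(p ∘ σ, fun j => (W j).submatrix σ id), ⟨⟨fun x => hp.1 _, ?_⟩, ?_, ?_⟩, ?_, ?_⟩
  · exact (Equiv.sum_comp σ p).trans hp.2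
  · intro x x' hx
    exact neg_le_neg_iff.1 (hρ hx)
  · exact fun j => ⟨fun x y => (hW j).1 _ _, fun x => (hW j).2 _⟩
  · funext z
    exact Equiv.sum_comp σ fun x => p x * jointChannel W x z
  · rw [Finset.abs_prod, Finset.abs_prod]
    refine Finset.prod_congr rfl fun j _ => ?_
    rw [Matrix.det_permute, abs_mul]
    rcases Int.units_eq_one_or (Equiv.Perm.sign σ) with h | h <;> simp [h]

theorem exists_isDCAFit [Nonempty X] (e : X ≃ Fin (Fintype.card X)) (q : (Fin K → X) → ℝ)
    {η : ℝ} (hη : 0 ≤ η) : ∃ c : (X → ℝ) × (Fin K → Matrix X X ℝ), IsDCAFit e η q c.1 c.2 := by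
  have hne : (dcaCandidates K e).Nonempty := by
    obtain ⟨c, hc, -⟩ := exists_mem_dcaCandidates (K := K) e
      (single_mem_stdSimplex ℝ (Classical.arbitrary X)) (W := fun _ => 1)
      fun j => ⟨fun x y => by simp only [Matrix.one_apply]; split_ifs <;> norm_num,
        fun x => by simp [Matrix.one_apply]⟩
    exact ⟨c, hc⟩
  obtain ⟨c, hc, hmin⟩ := (isCompact_dcaCandidates K e).exists_isMinOn hne
    (continuous_l1dist_outputDist q).continuousOn
  exact ⟨c, hc, fun c' hc' => (hmin hc').trans (le_add_of_nonneg_right hη)⟩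

/-- In a compact set of systems in which the output distribution of `(p, W)` determines its MCA
decoders, an output distribution close to that of `(p, W)` suffices: there are only finitely many
decoders, and being an MCA decoder is a closed condition on the system. -/
theorem exists_forall_isMCADecoder {d : X → X → ℝ} {p : X → ℝ} {W : Fin K → Matrix X X ℝ}
    {S : Set ((X → ℝ) × (Fin K → Matrix X X ℝ))} (hS : IsCompact S)
    (hSW : ∀ c ∈ S, outputDist c.1 c.2 = outputDist p W → ∀ f,
      IsMCADecoder d c.1 (jointChannel c.2) f → IsMCADecoder d p (jointChannel W) f) :
    ∃ κ, 0 < κ ∧ ∀ c ∈ S, l1dist (outputDist c.1 c.2) (outputDist p W) < κ → ∀ f,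
      IsMCADecoder d c.1 (jointChannel c.2) f → IsMCADecoder d p (jointChannel W) f := by
  set bad := S ∩ ⋃ (f : (Fin K → X) → X) (_ : ¬ IsMCADecoder d p (jointChannel W) f),
    {c : (X → ℝ) × (Fin K → Matrix X X ℝ) | IsMCADecoder d c.1 (jointChannel c.2) f} with hbad
  have hcpt : IsCompact bad := hS.inter_right <| isClosed_iUnion_of_finite fun f =>
    isClosed_iUnion_of_finite fun _ => isClosed_setOf_isMCADecoder d f
  have hmem : ∀ c ∈ S, ∀ f, IsMCADecoder d c.1 (jointChannel c.2) f →
      ¬ IsMCADecoder d p (jointChannel W) f → c ∈ bad := fun c hc f hf hf' =>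
    ⟨hc, Set.mem_iUnion₂.2 ⟨f, hf', hf⟩⟩
  rcases bad.eq_empty_or_nonempty with hemp | hne
  · refine ⟨1, one_pos, fun c hc _ f hf => ?_⟩
    by_contra hf'
    have := hmem c hc f hf hf'
    rw [hemp] at this
    exact this
  · obtain ⟨c₀, hc₀, hmin⟩ := hcpt.exists_isMinOn hne
      (continuous_l1dist_outputDist (outputDist p W)).continuousOn
    refine ⟨l1dist (outputDist c₀.1 c₀.2) (outputDist p W),
      (l1dist_nonneg _ _).lt_of_ne' fun h0 => ?_, fun c hc hlt f hf => ?_⟩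
    · obtain ⟨f, hf', hf⟩ := Set.mem_iUnion₂.1 hc₀.2
      exact hf' (hSW c₀ hc₀.1 (l1dist_eq_zero.1 h0) f hf)
    · by_contra hf'
      exact (hmin (hmem c hc f hf hf')).not_gt hlt

end Fits

/-! ### Universality -/

section Universality

variable {X : Type*} [Fintype X] [DecidableEq X] {K : ℕ} {d : X → X → ℝ} {p : X → ℝ}
  {W : Fin K → Matrix X X ℝ}

/-- The tolerance `n ^ (-1/4)`, which tends to zero, but more slowly than the random fluctuations
of the type of the columns. For `n = 0` the convention `1 / 0 = 0` applies. -/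
noncomputable def slowTolerance (n : ℕ) : ℝ := 1 / √√n

theorem slowTolerance_nonneg (n : ℕ) : 0 ≤ slowTolerance n := by
  unfold slowTolerance
  positivity

theorem tendsto_sqrt_natCast : Filter.Tendsto (fun n : ℕ => √(n : ℝ)) Filter.atTop Filter.atTop :=
  Real.tendsto_sqrt_atTop.comp tendsto_natCast_atTop_atTop

theorem tendsto_slowTolerance : Filter.Tendsto slowTolerance Filter.atTop (nhds 0) :=
  tendsto_const_nhds.div_atTop (Real.tendsto_sqrt_atTop.comp tendsto_sqrt_natCast)

theorem tendsto_div_mul_slowTolerance_sq (c : ℝ) :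
    Filter.Tendsto (fun n : ℕ => c / (n * slowTolerance n ^ 2)) Filter.atTop (nhds 0) := by
  have : ∀ n : ℕ, (n : ℝ) * slowTolerance n ^ 2 = √n := by
    intro n
    unfold slowTolerance
    rw [div_pow, Real.sq_sqrt (Real.sqrt_nonneg _), one_pow, mul_one_div, Real.div_sqrt]
  simp_rw [this]
  exact tendsto_const_nhds.div_atTop tendsto_sqrt_natCast

/-- An algorithm that applies MCA decoders of approximate fits is good, provided that the fits
come from a compact set in which the output distribution determines the MCA decoders. This is
only required if the type of the columns is typical. -/
theorem achieves_of_fits (hd : ∀ x x', 0 ≤ d x x') (hp : p ∈ stdSimplex ℝ X)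
    (hW : W ∈ channelTuples X K) {S : Set ((X → ℝ) × (Fin K → Matrix X X ℝ))} (hS : IsCompact S)
    (hSW : ∀ c ∈ S, outputDist c.1 c.2 = outputDist p W → ∀ f,
      IsMCADecoder d c.1 (jointChannel c.2) f → IsMCADecoder d p (jointChannel W) f)
    {η : ℕ → ℝ} (hη : Filter.Tendsto η Filter.atTop (nhds 0)) {C : Algorithms X K}
    (hC : ∀ n : ℕ, 0 < n → ∀ (x : Fin n → X) (y : Fin n → Fin K → X),
      l1dist (empirical y) (outputDist (empirical x) W) ≤ slowTolerance n →
      ∃ c ∈ S, ∃ f, IsMCADecoder d c.1 (jointChannel c.2) f ∧ (∀ i, C n y i = f (y i)) ∧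
        l1dist (outputDist c.1 c.2) (empirical y) ≤
          l1dist (outputDist (empirical x) W) (empirical y) + η n)
    {D : ℝ} (hD : dMCA d p (jointChannel W) < D) : Achieves d p W C D := by
  have hJ := isChannel_jointChannel hW
  refine achieves_of_isMCADecoder hd hp hW (fun ε hε => ?_) hD
  obtain ⟨κ, hκ, hstab⟩ := exists_forall_isMCADecoder hS hSW
  have h4 : 0 < κ / 4 := by linarith
  obtain ⟨N, hN⟩ := Filter.eventually_atTop.1 <|
    (tendsto_slowTolerance.eventually_lt_const h4).and <| (hη.eventually_lt_const h4).and <|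
    (tendsto_div_mul_slowTolerance_sq
      ((Fintype.card (Fin K → X) : ℝ) ^ 3)).eventually_lt_const hε
  refine ⟨N + 1, κ / 4, h4, fun n hn x hx => ?_⟩
  have hn0 : 0 < n := by omega
  obtain ⟨h1, h2, h3⟩ := hN n (by omega)
  have hpos : 0 < slowTolerance n := by
    have : (0 : ℝ) < n := by exact_mod_cast hn0
    unfold slowTolerance
    positivity
  refine lt_of_le_of_lt (prodProb_mono (fun i => hJ.1 (x i)) fun y hy => ?_)
    ((prob_l1dist_empirical_le hW hn0 x hpos).trans_lt h3)
  rw [Set.mem_ofPred_eq]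
  by_contra! hle
  obtain ⟨c, hc, f, hf, hCf, hfit⟩ := hC n hn0 x y hle
  refine hy ⟨f, hstab c hc ?_ f hf, hCf⟩
  rw [l1dist_comm (outputDist (empirical x) W)] at hfit
  have t1 := l1dist_triangle (outputDist c.1 c.2) (empirical y) (outputDist p W)
  have t2 := l1dist_triangle (empirical y) (outputDist (empirical x) W) (outputDist p W)
  have t3 := l1dist_outputDist_le hW (empirical x) p
  linarith

theorem exists_isUDDA [Nonempty X] (e : X ≃ Fin (Fintype.card X)) :
    ∃ C : Algorithms X K, IsUDDA d e (fun _ => 0) C := by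
  have h : ∀ (n : ℕ) (y : Fin n → Fin K → X), ∃ f : (Fin K → X) → X,
      ∃ (r : X → ℝ) (V : Fin K → Matrix X X ℝ), IsDCAFit e 0 (empirical y) r V ∧
        IsMCADecoder d r (jointChannel V) f := by
    intro n y
    obtain ⟨c, hc⟩ := exists_isDCAFit e (empirical y) le_rfl
    obtain ⟨f, hf⟩ := exists_isMCADecoder d c.1 (jointChannel c.2)
    exact ⟨f, c.1, c.2, hc, hf⟩
  choose f r V hfit hf using h
  exact ⟨fun n y i => f n y (y i), fun n y => ⟨r n y, V n y, f n y, hfit n y, hf n y, fun _ => rfl⟩⟩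

/-- For strictly positive distributions, all candidates with the output distribution of `(p, W)`
have invertible channels. -/
theorem IsUDDA.isUniversalOn [Nonempty X] (hK : 3 ≤ K) (hd : ∀ x x', 0 ≤ d x x')
    {e : X ≃ Fin (Fintype.card X)} {η : ℕ → ℝ} (hη : Filter.Tendsto η Filter.atTop (nhds 0))
    {C : Algorithms X K} (hC : IsUDDA d e η C) :
    IsUniversalOn d (posDistributions X) (invertibleTuples X K) C := by
  rintro p ⟨hp, hpos⟩ W hW D hD
  have hW' := invertibleTuples_subset hW
  rw [resolution_eq_dMCA hd hp hW'] at hD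
  refine achieves_of_fits hd hp hW' (isCompact_dcaCandidates K e) (fun c hc hout f hf => ?_) hη
    (fun n hn x y _ => ?_) hD
  · exact hf.of_outputDist_eq hK hW
      (mem_invertibleTuples_of_outputDist_eq hK (fun x => (hpos x).ne') hW hc.2.2 hout) hout
  · obtain ⟨r, V, f, hfit, hf, hCf⟩ := hC n y
    obtain ⟨c, hc, hout, -⟩ := exists_mem_dcaCandidates e (empirical_mem_stdSimplex x hn) hW'
    exact ⟨(r, V), hfit.1, f, hf, hCf, hout ▸ hfit.2 c hc⟩

/-- A universal version of UDDA: among all fits up to the tolerance, it selects one with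
the largest `|∏ det V j|`. If the type of the columns is typical, then the true channels together
with the type of the original are among these fits, so the channels of the selected
fit stay away from the non-invertible ones. -/
theorem exists_isUDDA_isUniversalOn [Nonempty X] (hK : 3 ≤ K) (hd : ∀ x x', 0 ≤ d x x')
    (e : X ≃ Fin (Fintype.card X)) :
    ∃ C : Algorithms X K, IsUDDA d e slowTolerance C ∧
      IsUniversalOn d (stdSimplex ℝ X) (invertibleTuples X K) C := by
  have hcont : Continuous fun c : (X → ℝ) × (Fin K → Matrix X X ℝ) => |∏ j, (c.2 j).det| :=
    (continuous_finsetProd _ fun j _ => Continuous.matrix_det (by fun_prop)).abs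
  have h : ∀ (n : ℕ) (y : Fin n → Fin K → X), ∃ f : (Fin K → X) → X,
      ∃ c : (X → ℝ) × (Fin K → Matrix X X ℝ), IsMCADecoder d c.1 (jointChannel c.2) f ∧
        IsDCAFit e (slowTolerance n) (empirical y) c.1 c.2 ∧
        ∀ c' : (X → ℝ) × (Fin K → Matrix X X ℝ),
          IsDCAFit e (slowTolerance n) (empirical y) c'.1 c'.2 →
          |∏ j, (c'.2 j).det| ≤ |∏ j, (c.2 j).det| := by
    intro n y
    obtain ⟨c, hc, hmax⟩ := (isCompact_setOf_isDCAFit e (slowTolerance n)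
      (empirical y)).exists_isMaxOn (exists_isDCAFit e (empirical y) (slowTolerance_nonneg n))
      hcont.continuousOn
    obtain ⟨f, hf⟩ := exists_isMCADecoder d c.1 (jointChannel c.2)
    exact ⟨f, c, hf, hc, fun c' hc' => hmax hc'⟩
  choose f c hf hfit hmax using h
  refine ⟨fun n y i => f n y (y i),
    fun n y => ⟨(c n y).1, (c n y).2, f n y, hfit n y, hf n y, fun _ => rfl⟩, ?_⟩
  intro p hp W hW D hD
  have hW' := invertibleTuples_subset hW
  rw [resolution_eq_dMCA hd hp hW'] at hD
  have hdet : 0 < |∏ j, (W j).det| := abs_pos.2 <| Finset.prod_ne_zero_iff.2 fun j _ =>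
    ((Matrix.isUnit_iff_isUnit_det _).1 (hW j).2).ne_zero
  refine achieves_of_fits hd hp hW' (S := dcaCandidates K e ∩
      {c | |∏ j, (W j).det| ≤ |∏ j, (c.2 j).det|})
    ((isCompact_dcaCandidates K e).inter_right (isClosed_le continuous_const hcont))
    (fun c hc hout f hf => ?_) tendsto_slowTolerance (fun n hn x y hle => ?_) hD
  · refine hf.of_outputDist_eq hK hW (fun j => ⟨hc.1.2.2 j, ?_⟩) hout
    rw [Matrix.isUnit_iff_isUnit_det, isUnit_iff_ne_zero]
    exact Finset.prod_ne_zero_iff.1 (abs_pos.1 (hdet.trans_le hc.2)) j (Finset.mem_univ j)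
  · obtain ⟨c', hc', hout, hdet'⟩ :=
      exists_mem_dcaCandidates e (empirical_mem_stdSimplex x hn) hW'
    have hfit' : IsDCAFit e (slowTolerance n) (empirical y) c'.1 c'.2 := by
      refine ⟨hc', fun c'' _ => ?_⟩
      rw [hout, l1dist_comm]
      exact hle.trans (le_add_of_nonneg_left (l1dist_nonneg _ _))
    exact ⟨c n y, ⟨(hfit n y).1, hdet'.symm.trans_le (hmax n y c' hfit')⟩, f n y, hf n y,
      fun _ => rfl, hout ▸ (hfit n y).2 c' hc'⟩

end Universality

end Denoising

theorem theorem1 {X : Type*} [Fintype X] [DecidableEq X] [Nonempty X] (K : ℕ) (hK : 3 ≤ K)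
    (d : X → X → ℝ) (hd : ∀ x x', 0 ≤ d x x') :
    (∀ p ∈ stdSimplex ℝ X, ∀ W ∈ Denoising.invertibleTuples X K,
      Denoising.resolution d p W = Denoising.dMCA d p (Denoising.jointChannel W) ∧
      ((∀ (σ : Equiv.Perm X) (x x' : X), d (σ x) (σ x') = d x x') →
        Denoising.resolution d p W = Denoising.dMCAParts d p (Denoising.jointChannel W))) ∧
    (∀ e : X ≃ Fin (Fintype.card X),
      (∃ (η : ℕ → ℝ) (C : Denoising.Algorithms X K), Filter.Tendsto η Filter.atTop (nhds 0) ∧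
        Denoising.IsUDDA d e η C ∧
        Denoising.IsUniversalOn d (stdSimplex ℝ X) (Denoising.invertibleTuples X K) C) ∧
      (∃ C : Denoising.Algorithms X K, Denoising.IsUDDA d e (fun _ => 0) C) ∧
      ∀ (η : ℕ → ℝ) (C : Denoising.Algorithms X K), Filter.Tendsto η Filter.atTop (nhds 0) →
        Denoising.IsUDDA d e η C →
        Denoising.IsUniversalOn d (Denoising.posDistributions X)
          (Denoising.invertibleTuples X K) C) := by
  refine ⟨fun p hp W hW => ?_, fun e => ⟨?_, Denoising.exists_isUDDA e,
    fun η C hη hC => hC.isUniversalOn hK hd hη⟩⟩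
  · have h := Denoising.resolution_eq_dMCA hd hp (Denoising.invertibleTuples_subset hW)
    exact ⟨h, fun hinv => h.trans (Denoising.dMCAParts_eq hinv).symm⟩
  · obtain ⟨C, hC, huniv⟩ := Denoising.exists_isUDDA_isUniversalOn (d := d) hK hd e
    exact ⟨_, C, Denoising.tendsto_slowTolerance, hC, huniv⟩
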